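/- Let $\mathbb{D}=\{z\in\mathbb{C}:|z|<1\}$. Let $H^2(\mathbb{D})$ be the space of analytic functions $f$ on $\mathbb{D}$ with $$\|f\|^2=\sup_{0<r<1}\frac1{2\pi}\int_0^{2\pi}|f(re^{i\theta})|^2\,d\theta<\infty,$$ and let $H^\infty(\mathbb{D})$ be the space of bounded analytic functions on $\mathbb{D}$. Let $\varphi$ be a parabolic automorphism of $\mathbb{D}$, i.e. a holomorphic bijection of $\mathbb{D}$ onto itself whose continuous extension to $\overline{\mathbb{D}}$ has exactly one fixed point on $\partial\mathbb{D}$. Let $a\in\partial\mathbb{D}$ be its Denjoy–Wolff point, i.e. the fixed point to which the iterates of $\varphi$ converge uniformly on compact subsets of $\mathbb{D}$. Let $\psi\in H^\infty(\mathbb{D})$ be continuous at $a$, i.e. $\psi(z)$ has a finite limit, denoted $\psi(a)$, as $z\to a$ with $z\in\mathbb{D}$. Then $C_{\psi,\varphi}f=\psi\cdot(f\circ\varphi)$ defines a bounded linear operator on $H^2(\mathbb{D})$, and if $C_{\psi,\varphi}$ is not invertible, then its spectrum on $H^2(\mathbb{D})$ is $$\{\lambda\in\mathbb{C}:|\lambda|\le|\psi(a)|\}.$$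 -/

import Mathlib

open Set Filter Topology Metric

noncomputable section

namespace WCO

/-! ## The Hardy space `H²` of the unit disc `ball (0 : ℂ) 1` -/

/-- The integral mean `(1 / 2π) ∫_0^{2π} |f (r e^{iθ})|² dθ`. -/
def hardyMean (f : ℂ → ℂ) (r : ℝ) : ℝ :=
  Real.circleAverage (fun z => ‖f z‖ ^ 2) 0 r

lemma hardyMean_eq (f : ℂ → ℂ) (r : ℝ) :
    hardyMean f r =
      ∫ θ in (0 : ℝ)..2 * Real.pi,
        ‖f (r * Complex.exp (θ * Complex.I))‖ ^ 2 / (2 * Real.pi) := by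
  simp [hardyMean, Real.circleAverage, circleMap, div_eq_inv_mul]

/-- Membership in `H²`: `f` is analytic on the unit disc and its integral means are bounded.
An analytic function on the disc is represented by the function on `ℂ` that agrees with it on the
disc and is `0` elsewhere, so that two members are equal exactly when they agree on the disc. -/
structure MemHardy (f : ℂ → ℂ) : Prop where
  analytic : DifferentiableOn ℂ f (ball 0 1)
  bdd : BddAbove (hardyMean f '' Ioo 0 1)
  eq_zero_off : ∀ z, z ∉ ball (0 : ℂ) 1 → f z = 0

lemma hardyMean_nonneg (f : ℂ → ℂ) (r : ℝ) : 0 ≤ hardyMean f r :=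
  Real.circleAverage_nonneg_of_nonneg fun _ _ => by positivity

lemma hardyMean_smul (c : ℂ) (f : ℂ → ℂ) (r : ℝ) :
    hardyMean (c • f) r = ‖c‖ ^ 2 * hardyMean f r := by
  have h : (fun z => ‖(c • f) z‖ ^ 2) = fun z => (‖c‖ ^ 2) • (‖f z‖ ^ 2) := by
    funext z; simp [mul_pow]
  rw [hardyMean, h, Real.circleAverage_fun_smul]; rfl

lemma continuousOn_sphere {f : ℂ → ℂ} (hf : DifferentiableOn ℂ f (ball 0 1)) {r : ℝ}
    (hr : r ∈ Ioo (0 : ℝ) 1) : ContinuousOn (fun z => ‖f z‖ ^ 2) (sphere 0 r) :=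
  ((hf.continuousOn.mono (sphere_subset_ball hr.2)).norm).pow 2

lemma hardyMean_add_le {f g : ℂ → ℂ} (hf : DifferentiableOn ℂ f (ball 0 1))
    (hg : DifferentiableOn ℂ g (ball 0 1)) {r : ℝ} (hr : r ∈ Ioo (0 : ℝ) 1) {a b : ℝ}
    (ha : 0 < a) (hb : 0 < b) :
    hardyMean (f + g) r ≤ (1 + b / a) * hardyMean f r + (1 + a / b) * hardyMean g r := by
  have If := (continuousOn_sphere hf hr).circleIntegrable hr.1.le
  have Ig := (continuousOn_sphere hg hr).circleIntegrable hr.1.le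
  have Is := (continuousOn_sphere (hf.add hg) hr).circleIntegrable hr.1.le
  have If' : CircleIntegrable (fun z => (1 + b / a) • (‖f z‖ ^ 2)) 0 r :=
    ((continuousOn_sphere hf hr).const_smul (1 + b / a)).circleIntegrable hr.1.le
  have Ig' : CircleIntegrable (fun z => (1 + a / b) • (‖g z‖ ^ 2)) 0 r :=
    ((continuousOn_sphere hg hr).const_smul (1 + a / b)).circleIntegrable hr.1.le
  have key : Real.circleAverage (fun z => ‖(f + g) z‖ ^ 2) 0 r ≤
      Real.circleAverage
        (fun z => (1 + b / a) • (‖f z‖ ^ 2) + (1 + a / b) • (‖g z‖ ^ 2)) 0 r := by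
    refine Real.circleAverage_mono Is (If'.add Ig') fun z _ => ?_
    have h1 : ‖(f + g) z‖ ^ 2 ≤ (‖f z‖ + ‖g z‖) ^ 2 := by
      have := norm_add_le (f z) (g z)
      simp only [Pi.add_apply]
      gcongr
    have h2 : (1 + b / a) • (‖f z‖ ^ 2) + (1 + a / b) • (‖g z‖ ^ 2) - (‖f z‖ + ‖g z‖) ^ 2
        = (b * ‖f z‖ - a * ‖g z‖) ^ 2 / (a * b) := by
      simp only [smul_eq_mul]
      field_simp
      ring
    have h3 : 0 ≤ (b * ‖f z‖ - a * ‖g z‖) ^ 2 / (a * b) := by positivity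
    linarith
  rw [Real.circleAverage_fun_add If' Ig', Real.circleAverage_fun_smul,
    Real.circleAverage_fun_smul] at key
  exact key

lemma MemHardy.add {f g : ℂ → ℂ} (hf : MemHardy f) (hg : MemHardy g) : MemHardy (f + g) := by
  refine ⟨hf.analytic.add hg.analytic, ?_, fun z hz => ?_⟩
  · obtain ⟨A, hA⟩ := hf.bdd
    obtain ⟨B, hB⟩ := hg.bdd
    refine ⟨2 * A + 2 * B, ?_⟩
    rintro _ ⟨r, hr, rfl⟩
    have h := hardyMean_add_le hf.analytic hg.analytic hr one_pos one_pos
    have h1 := hA ⟨r, hr, rfl⟩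
    have h2 := hB ⟨r, hr, rfl⟩
    norm_num at h
    linarith
  · simp [hf.eq_zero_off z hz, hg.eq_zero_off z hz]

lemma MemHardy.smul (c : ℂ) {f : ℂ → ℂ} (hf : MemHardy f) : MemHardy (c • f) := by
  refine ⟨hf.analytic.const_smul c, ?_, fun z hz => by simp [hf.eq_zero_off z hz]⟩
  obtain ⟨A, hA⟩ := hf.bdd
  refine ⟨‖c‖ ^ 2 * A, ?_⟩
  rintro _ ⟨r, hr, rfl⟩
  rw [hardyMean_smul]
  exact mul_le_mul_of_nonneg_left (hA ⟨r, hr, rfl⟩) (by positivity)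

lemma MemHardy.zero : MemHardy 0 := by
  refine ⟨differentiableOn_const 0, ⟨0, ?_⟩, fun z _ => rfl⟩
  rintro _ ⟨r, -, rfl⟩
  simp [hardyMean, Real.circleAverage]

/-- `H²` as a space of functions, with pointwise operations. -/
def hardySubmodule : Submodule ℂ (ℂ → ℂ) where
  carrier := {f | MemHardy f}
  add_mem' := MemHardy.add
  zero_mem' := MemHardy.zero
  smul_mem' c _ hf := hf.smul c

/-- The Hardy space `H²` of the unit disc; it carries no topology but that of its norm below. -/
def H2 : Type := hardySubmodule

namespace H2

instance : AddCommGroup H2 := inferInstanceAs (AddCommGroup hardySubmodule)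

instance : Module ℂ H2 := inferInstanceAs (Module ℂ hardySubmodule)

instance : CoeFun H2 (fun _ => ℂ → ℂ) := ⟨fun f => f.1⟩

/-- `‖f‖² = sup_{0 < r < 1} (1 / 2π) ∫_0^{2π} |f (r e^{iθ})|² dθ`. -/
instance : Norm H2 := ⟨fun f => Real.sqrt (sSup (hardyMean f '' Ioo 0 1))⟩

lemma norm_def (f : H2) : ‖f‖ = Real.sqrt (sSup (hardyMean f '' Ioo 0 1)) := rfl

lemma coe_add (f g : H2) : ⇑(f + g) = ⇑f + ⇑g := rfl

lemma coe_smul (c : ℂ) (f : H2) : ⇑(c • f) = c • ⇑f := rfl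

lemma mem (f : H2) : MemHardy f := f.2

lemma image_nonempty (f : H2) : (hardyMean f '' Ioo 0 1).Nonempty :=
  ⟨_, 1 / 2, ⟨by norm_num, by norm_num⟩, rfl⟩

lemma hardyMean_le (f : H2) {r : ℝ} (hr : r ∈ Ioo (0 : ℝ) 1) : hardyMean f r ≤ ‖f‖ ^ 2 := by
  have h := le_csSup f.mem.bdd ⟨r, hr, rfl⟩
  rw [norm_def, Real.sq_sqrt ((hardyMean_nonneg f r).trans h)]
  exact h

lemma norm_le {f : H2} {a : ℝ} (ha : 0 ≤ a)
    (h : ∀ r ∈ Ioo (0 : ℝ) 1, hardyMean f r ≤ a ^ 2) : ‖f‖ ≤ a := by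
  rw [norm_def, Real.sqrt_le_left ha]
  refine csSup_le f.image_nonempty ?_
  rintro _ ⟨r, hr, rfl⟩
  exact h r hr

lemma norm_nonneg' (f : H2) : 0 ≤ ‖f‖ := Real.sqrt_nonneg _

lemma norm_add_le' (f g : H2) : ‖f + g‖ ≤ ‖f‖ + ‖g‖ := by
  refine le_of_forall_pos_le_add fun ε hε => ?_
  have hf := f.norm_nonneg'
  have hg := g.norm_nonneg'
  have ha : 0 < ‖f‖ + ε / 2 := by linarith
  have hb : 0 < ‖g‖ + ε / 2 := by linarith
  have : ‖f + g‖ ≤ (‖f‖ + ε / 2) + (‖g‖ + ε / 2) := by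
    refine norm_le (by linarith) fun r hr => ?_
    have h := hardyMean_add_le f.mem.analytic g.mem.analytic hr ha hb
    have h1 : hardyMean f r ≤ (‖f‖ + ε / 2) ^ 2 :=
      (f.hardyMean_le hr).trans (by gcongr; linarith)
    have h2 : hardyMean g r ≤ (‖g‖ + ε / 2) ^ 2 :=
      (g.hardyMean_le hr).trans (by gcongr; linarith)
    rw [coe_add]
    generalize ‖f‖ + ε / 2 = a at *
    generalize ‖g‖ + ε / 2 = b at *
    calc _ ≤ _ := h
      _ ≤ (1 + b / a) * a ^ 2 + (1 + a / b) * b ^ 2 := by gcongr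
      _ = (a + b) ^ 2 := by field_simp; ring
  linarith

lemma norm_smul' (c : ℂ) (f : H2) : ‖c • f‖ = ‖c‖ * ‖f‖ := by
  have key : ∀ (c : ℂ) (f : H2), ‖c • f‖ ≤ ‖c‖ * ‖f‖ := fun c f => by
    refine norm_le (mul_nonneg (norm_nonneg c) f.norm_nonneg') fun r hr => ?_
    rw [coe_smul, hardyMean_smul, mul_pow]
    exact mul_le_mul_of_nonneg_left (f.hardyMean_le hr) (by positivity)
  refine le_antisymm (key c f) ?_
  rcases eq_or_ne c 0 with rfl | hc
  · simpa using norm_nonneg' ((0 : ℂ) • f)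
  · have h := key c⁻¹ (c • f)
    rw [inv_smul_smul₀ hc, norm_inv] at h
    have hc' : 0 < ‖c‖ := norm_pos_iff.2 hc
    calc ‖c‖ * ‖f‖ ≤ ‖c‖ * (‖c‖⁻¹ * ‖c • f‖) := by gcongr
      _ = ‖c • f‖ := by field_simp

lemma eq_zero_of_norm {f : H2} (h : ‖f‖ = 0) : f = 0 := by
  have h0 : ∀ z ∈ ball (0 : ℂ) 1, z ≠ 0 → f z = 0 := by
    intro z hz hz0
    by_contra hne
    have hr : ‖z‖ ∈ Ioo (0 : ℝ) 1 := ⟨norm_pos_iff.2 hz0, by simpa using hz⟩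
    have hle := f.hardyMean_le hr
    rw [h] at hle
    have hpos : 0 < ∫ θ in (0 : ℝ)..2 * Real.pi, ‖f (circleMap 0 ‖z‖ θ)‖ ^ 2 := by
      refine intervalIntegral.integral_pos Real.two_pi_pos ?_ (fun _ _ => by positivity) ?_
      · exact (continuousOn_sphere f.mem.analytic hr).comp (continuous_circleMap 0 _).continuousOn
          fun θ _ => circleMap_mem_sphere 0 hr.1.le θ
      · have hz' : z ∈ circleMap 0 ‖z‖ '' Ioc 0 (2 * Real.pi) := by
          rw [image_circleMap_Ioc]
          simp
        obtain ⟨θ, hθ, hθz⟩ := hz'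
        refine ⟨θ, Ioc_subset_Icc_self hθ, ?_⟩
        rw [hθz]
        exact pow_pos (norm_pos_iff.2 hne) 2
    have : 0 < hardyMean f ‖z‖ := by
      rw [hardyMean, Real.circleAverage, smul_eq_mul]
      exact mul_pos (inv_pos.2 Real.two_pi_pos) hpos
    linarith
  have h1 : f 0 = 0 := by
    have hc : ContinuousAt f 0 :=
      f.mem.analytic.continuousOn.continuousAt (ball_mem_nhds 0 one_pos)
    have ht : Tendsto f (𝓝[≠] (0 : ℂ)) (𝓝 0) := by
      refine Tendsto.congr' ?_ tendsto_const_nhds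
      filter_upwards [self_mem_nhdsWithin, mem_nhdsWithin_of_mem_nhds
        (ball_mem_nhds (0 : ℂ) one_pos)] with z hz hz'
      exact (h0 z hz' hz).symm
    exact tendsto_nhds_unique (hc.tendsto.mono_left nhdsWithin_le_nhds) ht
  apply Subtype.ext
  funext z
  by_cases hz : z ∈ ball (0 : ℂ) 1
  · rcases eq_or_ne z 0 with rfl | hz0
    · exact h1
    · exact h0 z hz hz0
  · exact f.mem.eq_zero_off z hz

lemma normedSpaceCore : NormedSpace.Core ℂ H2 where
  norm_nonneg := norm_nonneg'
  norm_smul := norm_smul'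
  norm_triangle := norm_add_le'
  norm_eq_zero_iff f := ⟨eq_zero_of_norm, fun h => by
    simpa [h] using norm_smul' 0 f⟩

instance : NormedAddCommGroup H2 := NormedAddCommGroup.ofCore normedSpaceCore

instance : NormedSpace ℂ H2 := NormedSpace.ofCore normedSpaceCore

end H2

/-- `ψ ∈ H^∞`: `ψ` is bounded and analytic on the unit disc. Only the values of `ψ` on the disc
matter. -/
def MemHInfty (ψ : ℂ → ℂ) : Prop :=
  DifferentiableOn ℂ ψ (ball 0 1) ∧ ∃ M : ℝ, ∀ z ∈ ball (0 : ℂ) 1, ‖ψ z‖ ≤ M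

/-! ## Automorphisms of the unit disc -/

/-- `φ` is an automorphism of the unit disc: a holomorphic bijection of the disc onto itself. Only
the values of `φ` on the disc matter. -/
def IsDiscAut (φ : ℂ → ℂ) : Prop :=
  DifferentiableOn ℂ φ (ball 0 1) ∧ BijOn φ (ball 0 1) (ball 0 1)

/-- `b` is a point of the unit circle fixed by (the continuous extension to the closed disc of)
`φ`, i.e. `φ z → b` as `z → b` inside the disc. -/
def IsBoundaryFixedPoint (φ : ℂ → ℂ) (b : ℂ) : Prop :=
  b ∈ sphere (0 : ℂ) 1 ∧ Tendsto φ (𝓝[ball 0 1] b) (𝓝 b)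

/-- A parabolic automorphism: it has exactly one fixed point on the unit circle. -/
def IsParabolicAut (φ : ℂ → ℂ) : Prop :=
  IsDiscAut φ ∧ ∃! b, IsBoundaryFixedPoint φ b

/-- `a` is the Denjoy–Wolff point of `φ` (on the unit circle): the fixed point to which the
iterates of `φ` converge, uniformly on every compact subset of the disc. -/
def IsDenjoyWolffPoint (φ : ℂ → ℂ) (a : ℂ) : Prop :=
  IsBoundaryFixedPoint φ a ∧
    ∀ K : Set ℂ, K ⊆ ball 0 1 → IsCompact K →
      TendstoUniformlyOn (fun (n : ℕ) z => φ^[n] z) (fun _ => a) atTop K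

/-! ## Weighted composition operators -/

/-- The bounded operator `T` on `H²` is the weighted composition operator `C_{ψ,φ}`, that is,
`T f = ψ · (f ∘ φ)` on the unit disc. There is at most one such `T`. -/
def IsWeightedComposition (ψ φ : ℂ → ℂ) (T : H2 →L[ℂ] H2) : Prop :=
  ∀ f : H2, ∀ z ∈ ball (0 : ℂ) 1, T f z = ψ z * f (φ z)

lemma IsWeightedComposition.unique {ψ φ : ℂ → ℂ} {S T : H2 →L[ℂ] H2}
    (hS : IsWeightedComposition ψ φ S) (hT : IsWeightedComposition ψ φ T) : S = T := by
  refine ContinuousLinearMap.ext fun f => Subtype.ext (funext fun z => ?_)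
  by_cases hz : z ∈ ball (0 : ℂ) 1
  · exact (hS f z hz).trans (hT f z hz).symm
  · exact ((S f).mem.eq_zero_off z hz).trans ((T f).mem.eq_zero_off z hz).symm

end WCO

end

/-!
In the half-plane coordinate `w = (a + z) / (a - z)` on the right half-plane, a parabolic
automorphism with fixed point `a` is a translation `w ↦ w + i t`, `t ≠ 0`
(`IsParabolicAut.exists_eqOn_affDisc`). Composed with an affine map of the half-plane, `φ` fixes
the origin, hence is a rotation by the Schwarz lemma; it also fixes `a`, so it is the identity. Thus
`φ` is affine in `w`, and a second boundary fixed point exists unless it is a proper translation.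
Boundedness of `C = C_{ψ,φ}` is Littlewood's subordination principle (`hardyMean_comp_le`), from the
harmonic majorant of `|f|²` given by the Herglotz integral; it also gives the bound of order
`(1 - |z|²)^{-1/2}` for point evaluations.

*Upper bound* (`norm_le_of_mem_spectrum`). `C ^ n` is a weighted composition operator whose weight
is the product of `ψ` along an orbit. The orbit moves with constant speed in the half-plane, so all
but boundedly many factors are close to `ψ a`, while the norm of composition with `φ^[n]` is `O(n)`.

*Lower bound* (`mem_spectrum_of_norm_lt`). Let `0 < |l| < |ψ a|`, suppose that `l - C` has inverse
`D`, and let `z₀` be a point whose backward orbit `φ⁻¹ z₀, φ⁻² z₀, …` avoids the zeros of `ψ`.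
There is a `g` in `H²` that vanishes on this backward orbit, whose norm is at most that of the
reproducing kernel at `z₀`, and whose value at `z₀` is comparable to that of the kernel
(`H2.exists_vanishing_on_orbit`). For `f = D g` the
equation `l f - ψ · (f ∘ φ) = g` is on the backward orbit the recursion
`l f(φ⁻ᵏ⁻¹ z₀) = ψ(φ⁻ᵏ⁻¹ z₀) f(φ⁻ᵏ z₀)`, whose nonzero solutions grow geometrically, whereas members
of `H²` grow at most linearly there (`H2.apply_eq_zero_of_recursion`). Hence `f z₀ = 0` and
`g z₀ = - ψ z₀ · f (φ z₀)`, which bounds `|ψ z₀|` from below, uniformly for `z₀` away from `a`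
(`IsWeightedComposition.exp_le_of_mul_eq_one`). If `C` is not invertible this is violated: either
`ψ` has a zero, and one may take the last zero along its backward orbit, or `ψ` has no zero but
`inf |ψ| = 0`, and the infimum is approached away from `a`. The circle `|l| = |ψ a|` follows because
the spectrum is closed.
-/

open Set Filter Topology Metric

noncomputable section

namespace WCO

/-! ### Harmonic majorants and Littlewood's subordination principle -/

/-- The Herglotz integral of `|f|²` over the circle of radius `ρ`, an analytic function on the disc
of radius `ρ` whose real part is the least harmonic majorant of `|f|²` there. -/
def herglotzMajorant (f : ℂ → ℂ) (ρ : ℝ) (z : ℂ) : ℂ :=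
  Real.circleAverage (fun ζ => herglotzRieszKernel 0 z ζ • ((‖f ζ‖ ^ 2 : ℝ) : ℂ)) 0 ρ

section Majorant

variable {f : ℂ → ℂ} {ρ : ℝ} {z : ℂ}

lemma circleIntegrable_norm_sq (hf : DifferentiableOn ℂ f (ball 0 1)) (hρ : ρ ∈ Ioo (0 : ℝ) 1) :
    CircleIntegrable (fun ζ => ‖f ζ‖ ^ 2) 0 ρ :=
  (continuousOn_sphere hf hρ).circleIntegrable hρ.1.le

lemma differentiableOn_herglotzMajorant (hf : DifferentiableOn ℂ f (ball 0 1))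
    (hρ : ρ ∈ Ioo (0 : ℝ) 1) : DifferentiableOn ℂ (herglotzMajorant f ρ) (ball 0 ρ) := by
  refine differentiableOn_circleAverage_herglotzRieszKernel_smul ?_
  exact (Complex.continuous_ofReal.comp_continuousOn
    (continuousOn_sphere hf hρ)).circleIntegrable hρ.1.le

lemma re_herglotzMajorant (hf : DifferentiableOn ℂ f (ball 0 1)) (hρ : ρ ∈ Ioo (0 : ℝ) 1)
    (hz : z ∈ ball (0 : ℂ) ρ) :
    (herglotzMajorant f ρ z).re =
      Real.circleAverage (fun ζ => (herglotzRieszKernel 0 z ζ).re * ‖f ζ‖ ^ 2) 0 ρ :=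
  re_circleAverage_herglotzRieszKernel_smul (circleIntegrable_norm_sq hf hρ) hz

lemma continuousOn_re_herglotz_mul (hf : DifferentiableOn ℂ f (ball 0 1))
    (hρ : ρ ∈ Ioo (0 : ℝ) 1) (hz : z ∈ ball (0 : ℂ) ρ) :
    ContinuousOn (fun ζ => (herglotzRieszKernel 0 z ζ).re * ‖f ζ‖ ^ 2) (sphere 0 ρ) := by
  have h := continuousOn_herglotzRieszKernel_sphere hz
  rw [abs_of_pos hρ.1] at h
  exact (Complex.continuous_re.comp_continuousOn h).mul (continuousOn_sphere hf hρ)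

lemma norm_sq_le_re_herglotzMajorant (hf : DifferentiableOn ℂ f (ball 0 1))
    (hρ : ρ ∈ Ioo (0 : ℝ) 1) (hz : z ∈ ball (0 : ℂ) ρ) :
    ‖f z‖ ^ 2 ≤ (herglotzMajorant f ρ z).re := by
  have hd : DiffContOnCl ℂ (fun ζ => f ζ ^ 2) (ball 0 ρ) := by
    refine DifferentiableOn.diffContOnCl ?_
    rw [closure_ball 0 hρ.1.ne']
    exact (hf.mono (closedBall_subset_ball hρ.2)).pow 2
  rw [re_herglotzMajorant hf hρ hz, ← norm_pow,
    ← hd.circleAverage_re_herglotzRieszKernel_smul hz, Real.circleAverage, Real.circleAverage,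
    norm_smul, smul_eq_mul, Real.norm_of_nonneg (inv_nonneg.2 Real.two_pi_pos.le)]
  refine mul_le_mul_of_nonneg_left ?_ (inv_nonneg.2 Real.two_pi_pos.le)
  refine (intervalIntegral.norm_integral_le_integral_norm Real.two_pi_pos.le).trans_eq ?_
  refine intervalIntegral.integral_congr fun θ _ => ?_
  have hpos : 0 ≤ (herglotzRieszKernel 0 z (circleMap 0 ρ θ)).re := by
    refine le_trans ?_ (le_re_herglotzRieszKernel (circleMap_mem_sphere 0 hρ.1.le θ) hz)
    have : ‖z‖ < ρ := by simpa using hz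
    rw [sub_zero]
    exact div_nonneg (sub_nonneg.2 this.le) (by linarith [norm_nonneg z])
  simp only [Pi.smul_apply', Function.comp_apply, norm_smul, norm_pow]
  rw [Real.norm_of_nonneg hpos]

lemma re_herglotzMajorant_le (hf : DifferentiableOn ℂ f (ball 0 1)) (hρ : ρ ∈ Ioo (0 : ℝ) 1)
    (hz : z ∈ ball (0 : ℂ) ρ) :
    (herglotzMajorant f ρ z).re ≤ (ρ + ‖z‖) / (ρ - ‖z‖) * hardyMean f ρ := by
  rw [re_herglotzMajorant hf hρ hz, hardyMean, ← smul_eq_mul (_ / _), ← Real.circleAverage_fun_smul]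
  refine Real.circleAverage_mono
    ((continuousOn_re_herglotz_mul hf hρ hz).circleIntegrable hρ.1.le)
    ((continuousOn_const.mul (continuousOn_sphere hf hρ)).circleIntegrable hρ.1.le) fun ζ hζ => ?_
  rw [abs_of_pos hρ.1] at hζ
  have h := re_herglotzRieszKernel_le hζ hz
  rw [sub_zero z] at h
  exact mul_le_mul_of_nonneg_right (by simpa [herglotzRieszKernel_def] using h) (by positivity)

/-- **Littlewood's subordination principle**, with the growth factor for `φ 0 ≠ 0`. -/
lemma hardyMean_comp_le {φ : ℂ → ℂ} {r : ℝ} (hf : DifferentiableOn ℂ f (ball 0 1))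
    (hρ : ρ ∈ Ioo (0 : ℝ) 1) (hr : 0 < r) (hφ : DifferentiableOn ℂ φ (closedBall 0 r))
    (hm : MapsTo φ (closedBall 0 r) (ball 0 ρ)) :
    hardyMean (f ∘ φ) r ≤ (ρ + ‖φ 0‖) / (ρ - ‖φ 0‖) * hardyMean f ρ := by
  have h0 : φ 0 ∈ ball (0 : ℂ) ρ := hm (mem_closedBall_self hr.le)
  have hU : DifferentiableOn ℂ (herglotzMajorant f ρ ∘ φ) (closedBall 0 r) :=
    (differentiableOn_herglotzMajorant hf hρ).comp hφ hm
  have hUc : ContinuousOn (herglotzMajorant f ρ ∘ φ) (sphere 0 r) :=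
    hU.continuousOn.mono sphere_subset_closedBall
  have hfc : ContinuousOn (fun z => ‖(f ∘ φ) z‖ ^ 2) (sphere 0 r) := by
    have : ContinuousOn (f ∘ φ) (closedBall 0 r) :=
      hf.continuousOn.comp hφ.continuousOn fun z hz => ball_subset_ball hρ.2.le (hm hz)
    exact ((this.mono sphere_subset_closedBall).norm).pow 2
  have havg : Real.circleAverage (herglotzMajorant f ρ ∘ φ) 0 r = herglotzMajorant f ρ (φ 0) := by
    have : DiffContOnCl ℂ (herglotzMajorant f ρ ∘ φ) (ball 0 |r|) := by
      refine DifferentiableOn.diffContOnCl ?_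
      rwa [abs_of_pos hr, closure_ball 0 hr.ne']
    exact this.circleAverage
  have hle : hardyMean (f ∘ φ) r ≤
      Real.circleAverage (Complex.reCLM ∘ (herglotzMajorant f ρ ∘ φ)) 0 r := by
    refine Real.circleAverage_mono (hfc.circleIntegrable hr.le)
      ((Complex.reCLM.continuous.comp_continuousOn hUc).circleIntegrable hr.le) fun z hz => ?_
    rw [abs_of_pos hr] at hz
    simp only [Function.comp_apply, Complex.reCLM_apply]
    exact norm_sq_le_re_herglotzMajorant hf hρ (hm (sphere_subset_closedBall hz))
  rw [Complex.reCLM.circleAverage_comp_comm (hUc.circleIntegrable hr.le), havg,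
    Complex.reCLM_apply] at hle
  exact hle.trans (re_herglotzMajorant_le hf hρ h0)

end Majorant

/-- The integral means of an analytic function increase with the radius. -/
lemma hardyMean_mono {f : ℂ → ℂ} (hf : DifferentiableOn ℂ f (ball 0 1)) {r ρ : ℝ} (hr : 0 < r)
    (hrρ : r < ρ) (hρ : ρ < 1) : hardyMean f r ≤ hardyMean f ρ := by
  have h := hardyMean_comp_le hf ⟨hr.trans hrρ, hρ⟩ hr (φ := id) differentiableOn_id
    fun z hz => closedBall_subset_ball hrρ hz
  simpa [div_self (hr.trans hrρ).ne'] using h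

/-- The limit `ρ → 1` of bounds by the Poisson kernel of the disc of radius `ρ`. -/
lemma le_of_forall_poisson_le {s t A N : ℝ} (hs : s < 1) (ht : t < 1)
    (h : ∀ ρ ∈ Ioo (0 : ℝ) 1, s < ρ → A ≤ (ρ + t) / (ρ - t) * N) :
    A ≤ (1 + t) / (1 - t) * N := by
  have hlim : Tendsto (fun ρ : ℝ => (ρ + t) / (ρ - t) * N) (𝓝[<] 1)
      (𝓝 ((1 + t) / (1 - t) * N)) := by
    have : ContinuousAt (fun ρ : ℝ => (ρ + t) / (ρ - t) * N) 1 := by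
      have h1 : (1 : ℝ) - t ≠ 0 := by linarith
      fun_prop (disch := assumption)
    exact this.tendsto.mono_left nhdsWithin_le_nhds
  refine ge_of_tendsto hlim ?_
  filter_upwards [Ioo_mem_nhdsLT (show (0 : ℝ) < 1 by norm_num), Ioo_mem_nhdsLT hs] with ρ h1 h2
  exact h ρ h1 h2.1

lemma H2.hardyMean_comp_le (f : H2) {φ : ℂ → ℂ} (hφ : DifferentiableOn ℂ φ (ball 0 1))
    (hm : MapsTo φ (ball 0 1) (ball 0 1)) {r : ℝ} (hr : r ∈ Ioo (0 : ℝ) 1) :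
    hardyMean (f ∘ φ) r ≤ (1 + ‖φ 0‖) / (1 - ‖φ 0‖) * ‖f‖ ^ 2 := by
  have hsub : closedBall (0 : ℂ) r ⊆ ball 0 1 := closedBall_subset_ball hr.2
  obtain ⟨x, hx, hmax⟩ := (isCompact_closedBall (0 : ℂ) r).exists_isMaxOn
    ⟨0, mem_closedBall_self hr.1.le⟩ (hφ.continuousOn.mono hsub).norm
  have hx1 : ‖φ x‖ < 1 := by simpa using hm (hsub hx)
  have h01 : ‖φ 0‖ < 1 := by simpa using hm (mem_ball_self one_pos)
  refine le_of_forall_poisson_le hx1 h01 fun ρ hρ hxρ => ?_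
  have hmaps : MapsTo φ (closedBall 0 r) (ball 0 ρ) := fun z hz => by
    simpa using (hmax hz).trans_lt hxρ
  have h0ρ : ‖φ 0‖ < ρ := by simpa using hmaps (mem_closedBall_self hr.1.le)
  refine (WCO.hardyMean_comp_le f.mem.analytic hρ hr.1 (hφ.mono hsub) hmaps).trans ?_
  exact mul_le_mul_of_nonneg_left (f.hardyMean_le hρ)
    (div_nonneg (by linarith [norm_nonneg (φ 0)]) (by linarith))

/-- Point evaluations are bounded on `H²`; the order `(1 - |z|²)^{-1/2}` is sharp. -/
lemma H2.norm_sq_apply_le (f : H2) {z : ℂ} (hz : z ∈ ball (0 : ℂ) 1) :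
    ‖f z‖ ^ 2 ≤ 4 / (1 - ‖z‖ ^ 2) * ‖f‖ ^ 2 := by
  have hz1 : ‖z‖ < 1 := by simpa using hz
  have h : ‖f z‖ ^ 2 ≤ (1 + ‖z‖) / (1 - ‖z‖) * ‖f‖ ^ 2 := by
    refine le_of_forall_poisson_le hz1 hz1 fun ρ hρ hzρ => ?_
    have hzρ' : z ∈ ball (0 : ℂ) ρ := by simpa using hzρ
    refine (norm_sq_le_re_herglotzMajorant f.mem.analytic hρ hzρ').trans
      ((re_herglotzMajorant_le f.mem.analytic hρ hzρ').trans ?_)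
    exact mul_le_mul_of_nonneg_left (f.hardyMean_le hρ)
      (div_nonneg (by linarith [norm_nonneg z]) (by linarith))
  refine h.trans (mul_le_mul_of_nonneg_right ?_ (by positivity))
  have h0 := norm_nonneg z
  rw [div_le_div_iff₀ (by linarith) (by nlinarith)]
  nlinarith [mul_nonneg (sub_nonneg.2 hz1.le) (sub_nonneg.2 hz1.le), mul_nonneg h0 h0]

/-! ### Completeness of `H²` -/

lemma hardyMean_le_of_norm_le {h : ℂ → ℂ} (hh : DifferentiableOn ℂ h (ball 0 1)) {r B : ℝ}
    (hr : r ∈ Ioo (0 : ℝ) 1) (hB : ∀ z ∈ sphere (0 : ℂ) r, ‖h z‖ ≤ B) : hardyMean h r ≤ B ^ 2 := by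
  refine Real.circleAverage_mono_on_of_le_circle (circleIntegrable_norm_sq hh hr) fun z hz => ?_
  rw [abs_of_pos hr.1] at hz
  exact pow_le_pow_left₀ (norm_nonneg _) (hB z hz) 2

lemma hardyMean_congr {f g : ℂ → ℂ} (h : EqOn f g (ball 0 1)) {r : ℝ} (hr : r ∈ Ioo (0 : ℝ) 1) :
    hardyMean f r = hardyMean g r := by
  refine Real.circleAverage_congr_sphere fun z hz => ?_
  rw [abs_of_pos hr.1] at hz
  simp only [h (sphere_subset_ball hr.2 hz)]

/-- A function satisfying `MemHardy`, as an element of `H²`. -/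
def H2.ofMemHardy {f : ℂ → ℂ} (hf : MemHardy f) : H2 := ⟨f, hf⟩

lemma H2.coe_ofMemHardy {f : ℂ → ℂ} (hf : MemHardy f) : ⇑(H2.ofMemHardy hf) = f := rfl

lemma H2.coe_sub (f g : H2) : ⇑(f - g) = ⇑f - ⇑g := rfl

lemma H2.norm_apply_le_of_closedBall (f : H2) {r : ℝ} (hr : r < 1) {z : ℂ}
    (hz : ‖z‖ ≤ r) : ‖f z‖ ≤ 2 / Real.sqrt (1 - r ^ 2) * ‖f‖ := by
  have h0 := norm_nonneg z
  have hr0 : 0 < 1 - r ^ 2 := by nlinarith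
  refine abs_le_of_sq_le_sq' ?_ (by positivity) |>.2
  rw [mul_pow, div_pow, Real.sq_sqrt hr0.le]
  refine (f.norm_sq_apply_le (by simpa using hz.trans_lt hr)).trans ?_
  norm_num
  gcongr

/-- A Cauchy sequence in `H²` converges locally uniformly on the disc. -/
lemma H2.exists_limit_of_cauchySeq {u : ℕ → H2} (hu : CauchySeq u) :
    ∃ F : ℂ → ℂ, DifferentiableOn ℂ F (ball 0 1) ∧ (∀ z, z ∉ ball (0 : ℂ) 1 → F z = 0) ∧
      ∀ r < 1, ∀ ε > 0, ∃ N, ∀ m ≥ N, ∀ z ∈ closedBall (0 : ℂ) r, ‖u m z - F z‖ ≤ ε := by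
  -- uniform Cauchy estimates on each smaller disc
  have hcau : ∀ r < 1, ∀ ε > 0, ∃ N, ∀ m ≥ N, ∀ n ≥ N, ∀ z ∈ closedBall (0 : ℂ) r,
      ‖u m z - u n z‖ ≤ ε := by
    intro r hr ε hε
    rcases lt_or_ge r 0 with hr0 | hr0
    · exact ⟨0, fun m _ n _ z hz => by simp [closedBall_eq_empty.2 hr0] at hz⟩
    have hs : 0 < Real.sqrt (1 - r ^ 2) := Real.sqrt_pos.2 (by nlinarith)
    obtain ⟨N, hN⟩ := Metric.cauchySeq_iff.1 hu (ε * Real.sqrt (1 - r ^ 2) / 2) (by positivity)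
    refine ⟨N, fun m hm n hn z hz => ?_⟩
    have h1 := (u m - u n).norm_apply_le_of_closedBall hr (by simpa using hz)
    rw [H2.coe_sub, Pi.sub_apply] at h1
    refine h1.trans ?_
    have h2 := (hN m hm n hn).le
    rw [dist_eq_norm] at h2
    calc 2 / Real.sqrt (1 - r ^ 2) * ‖u m - u n‖
        ≤ 2 / Real.sqrt (1 - r ^ 2) * (ε * Real.sqrt (1 - r ^ 2) / 2) := by gcongr
      _ = ε := by field_simp
  have hpt : ∀ z, ∃ l, Tendsto (fun n => u n z) atTop (𝓝 l) := by
    intro z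
    by_cases hz : z ∈ ball (0 : ℂ) 1
    · refine cauchySeq_tendsto_of_complete (Metric.cauchySeq_iff.2 fun ε hε => ?_)
      obtain ⟨N, hN⟩ := hcau ‖z‖ (by simpa using hz) (ε / 2) (by positivity)
      refine ⟨N, fun m hm n hn => ?_⟩
      rw [dist_eq_norm]
      exact (hN m hm n hn z (by simp)).trans_lt (by linarith)
    · exact ⟨0, by simp [fun n => (u n).mem.eq_zero_off z hz]⟩
  choose F hF using hpt
  have hunif : ∀ r < 1, ∀ ε > 0, ∃ N, ∀ m ≥ N, ∀ z ∈ closedBall (0 : ℂ) r, ‖u m z - F z‖ ≤ ε := by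
    intro r hr ε hε
    obtain ⟨N, hN⟩ := hcau r hr ε hε
    refine ⟨N, fun m hm z hz => ?_⟩
    refine le_of_tendsto ((tendsto_const_nhds.sub (hF z)).norm) ?_
    filter_upwards [eventually_ge_atTop N] with n hn using hN m hm n hn z hz
  refine ⟨F, ?_, fun z hz => tendsto_nhds_unique (hF z) ?_, hunif⟩
  · have hlu : TendstoLocallyUniformlyOn (fun n => ⇑(u n)) F atTop (ball 0 1) := by
      rw [tendstoLocallyUniformlyOn_iff_forall_isCompact isOpen_ball]
      intro K hK hKc
      obtain ⟨r, hr, hKr⟩ := exists_lt_subset_ball hKc.isClosed hK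
      rw [Metric.tendstoUniformlyOn_iff]
      intro ε hε
      obtain ⟨N, hN⟩ := hunif r hr (ε / 2) (by positivity)
      filter_upwards [eventually_ge_atTop N] with n hn z hz
      rw [dist_comm, dist_eq_norm]
      exact (hN n hn z (ball_subset_closedBall (hKr hz))).trans_lt (by linarith)
    exact hlu.differentiableOn (Eventually.of_forall fun n => (u n).mem.analytic) isOpen_ball
  · simp [fun n => (u n).mem.eq_zero_off z hz]

lemma H2.hardyMean_sub_le (f g : H2) {r : ℝ} (hr : r ∈ Ioo (0 : ℝ) 1) :
    hardyMean (⇑f - ⇑g) r ≤ ‖f - g‖ ^ 2 := by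
  rw [← H2.coe_sub]
  exact (f - g).hardyMean_le hr

lemma hardyMean_sub_le_add {f g h : ℂ → ℂ} (hf : DifferentiableOn ℂ f (ball 0 1))
    (hg : DifferentiableOn ℂ g (ball 0 1)) (hh : DifferentiableOn ℂ h (ball 0 1)) {r : ℝ}
    (hr : r ∈ Ioo (0 : ℝ) 1) :
    hardyMean (f - h) r ≤ 2 * hardyMean (f - g) r + 2 * hardyMean (g - h) r := by
  have h1 := hardyMean_add_le (hf.sub hg) (hg.sub hh) hr one_pos one_pos
  rw [sub_add_sub_cancel] at h1
  norm_num at h1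
  exact h1

instance : CompleteSpace H2 := by
  refine Metric.complete_of_cauchySeq_tendsto fun u hu => ?_
  obtain ⟨F, hFd, hF0, hunif⟩ := H2.exists_limit_of_cauchySeq hu
  have hmean : ∀ ε > 0, ∃ N, ∀ n ≥ N, ∀ r ∈ Ioo (0 : ℝ) 1,
      hardyMean (⇑(u n) - F) r ≤ ε ^ 2 := by
    intro ε hε
    obtain ⟨N, hN⟩ := Metric.cauchySeq_iff.1 hu (ε / 2) (by positivity)
    refine ⟨N, fun n hn r hr => ?_⟩
    obtain ⟨N', hN'⟩ := hunif r hr.2 (ε / 2) (by positivity)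
    have h1 := hardyMean_sub_le_add (u n).mem.analytic (u (max N N')).mem.analytic hFd hr
    have h2 : hardyMean (⇑(u n) - ⇑(u (max N N'))) r ≤ (ε / 2) ^ 2 := by
      refine ((u n).hardyMean_sub_le (u (max N N')) hr).trans ?_
      have := (hN n hn _ (le_max_left N N')).le
      rw [dist_eq_norm] at this
      gcongr
    have h3 : hardyMean (⇑(u (max N N')) - F) r ≤ (ε / 2) ^ 2 :=
      hardyMean_le_of_norm_le ((u (max N N')).mem.analytic.sub hFd) hr fun z hz =>
        hN' _ (le_max_right N N') z (sphere_subset_closedBall hz)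
    linarith
  have hFm : MemHardy F := by
    obtain ⟨N, hN⟩ := hmean 1 one_pos
    refine ⟨hFd, ⟨2 * ‖u N‖ ^ 2 + 2, ?_⟩, hF0⟩
    · rintro _ ⟨r, hr, rfl⟩
      have h1 := hardyMean_sub_le_add hFd (u N).mem.analytic (differentiableOn_const 0) hr
      have h2 : hardyMean (F - ⇑(u N)) r ≤ 1 := by
        have := hN N le_rfl r hr
        rw [one_pow] at this
        refine le_trans (le_of_eq ?_) this
        simp [hardyMean, norm_sub_rev]
      have h3 := (u N).hardyMean_le hr
      change hardyMean (F - 0) r ≤ _ + 2 * hardyMean (⇑(u N) - 0) r at h1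
      rw [sub_zero, sub_zero] at h1
      linarith
  refine ⟨H2.ofMemHardy hFm, Metric.tendsto_atTop.2 fun ε hε => ?_⟩
  obtain ⟨N, hN⟩ := hmean (ε / 2) (by positivity)
  refine ⟨N, fun n hn => ?_⟩
  rw [dist_eq_norm]
  have hle : ‖u n - H2.ofMemHardy hFm‖ ≤ ε / 2 := by
    refine H2.norm_le (by positivity) fun r hr => ?_
    rw [H2.coe_sub, H2.coe_ofMemHardy]
    exact hN n hn r hr
  exact hle.trans_lt (by linarith)

/-! ### Weighted composition operators -/

/-- The extension by zero of an analytic function on the disc with bounded means. -/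
lemma memHardy_indicator {f : ℂ → ℂ} (hf : DifferentiableOn ℂ f (ball 0 1)) {B : ℝ}
    (hB : ∀ r ∈ Ioo (0 : ℝ) 1, hardyMean f r ≤ B) : MemHardy ((ball 0 1).indicator f) where
  analytic := hf.congr fun z hz => indicator_of_mem hz f
  bdd := by
    refine ⟨B, ?_⟩
    rintro _ ⟨r, hr, rfl⟩
    rw [hardyMean_congr (fun z hz => indicator_of_mem hz f) hr]
    exact hB r hr
  eq_zero_off z hz := indicator_of_notMem hz f

lemma hardyMean_mul_le {ψ f : ℂ → ℂ} {M : ℝ} (hψ : DifferentiableOn ℂ ψ (ball 0 1))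
    (hM : ∀ z ∈ ball (0 : ℂ) 1, ‖ψ z‖ ≤ M) (hf : DifferentiableOn ℂ f (ball 0 1)) {r : ℝ}
    (hr : r ∈ Ioo (0 : ℝ) 1) : hardyMean (ψ * f) r ≤ M ^ 2 * hardyMean f r := by
  rw [hardyMean, hardyMean, ← smul_eq_mul (M ^ 2), ← Real.circleAverage_fun_smul]
  refine Real.circleAverage_mono (circleIntegrable_norm_sq (hψ.mul hf) hr)
    ((continuousOn_const.mul (continuousOn_sphere hf hr)).circleIntegrable hr.1.le) fun z hz => ?_
  rw [abs_of_pos hr.1] at hz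
  simp only [Pi.mul_apply, norm_mul, mul_pow, smul_eq_mul]
  have := hM z (sphere_subset_ball hr.2 hz)
  gcongr

lemma exists_isWeightedComposition {ψ φ : ℂ → ℂ} {M : ℝ} (hψ : DifferentiableOn ℂ ψ (ball 0 1))
    (hM : ∀ z ∈ ball (0 : ℂ) 1, ‖ψ z‖ ≤ M) (hφ : DifferentiableOn ℂ φ (ball 0 1))
    (hm : MapsTo φ (ball 0 1) (ball 0 1)) :
    ∃ C : H2 →L[ℂ] H2, IsWeightedComposition ψ φ C ∧
      ‖C‖ ≤ M * Real.sqrt ((1 + ‖φ 0‖) / (1 - ‖φ 0‖)) := by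
  have hM0 : 0 ≤ M := (norm_nonneg _).trans (hM 0 (mem_ball_self one_pos))
  have h01 : ‖φ 0‖ < 1 := by simpa using hm (mem_ball_self one_pos)
  have hq : 0 ≤ (1 + ‖φ 0‖) / (1 - ‖φ 0‖) :=
    div_nonneg (by linarith [norm_nonneg (φ 0)]) (by linarith)
  have hd : ∀ f : H2, DifferentiableOn ℂ (⇑f ∘ φ) (ball 0 1) := fun f => f.mem.analytic.comp hφ hm
  have hmean : ∀ f : H2, ∀ r ∈ Ioo (0 : ℝ) 1, hardyMean (ψ * (⇑f ∘ φ)) r ≤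
      (M * Real.sqrt ((1 + ‖φ 0‖) / (1 - ‖φ 0‖)) * ‖f‖) ^ 2 := by
    intro f r hr
    rw [mul_pow, mul_pow, Real.sq_sqrt hq, mul_assoc]
    exact (hardyMean_mul_le hψ hM (hd f) hr).trans
      (mul_le_mul_of_nonneg_left (f.hardyMean_comp_le hφ hm hr) (by positivity))
  let L : H2 →ₗ[ℂ] H2 :=
    { toFun := fun f => H2.ofMemHardy (memHardy_indicator (hψ.mul (hd f)) (hmean f))
      map_add' := fun f g => Subtype.ext <| funext fun z => by
        change (ball (0 : ℂ) 1).indicator (ψ * ((⇑f + ⇑g) ∘ φ)) z =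
          (ball (0 : ℂ) 1).indicator (ψ * (⇑f ∘ φ)) z + (ball (0 : ℂ) 1).indicator (ψ * (⇑g ∘ φ)) z
        by_cases hz : z ∈ ball (0 : ℂ) 1
        · simp only [indicator_of_mem hz, Pi.mul_apply, Function.comp_apply, Pi.add_apply, mul_add]
        · simp only [indicator_of_notMem hz, add_zero]
      map_smul' := fun c f => Subtype.ext <| funext fun z => by
        change (ball (0 : ℂ) 1).indicator (ψ * ((c • ⇑f) ∘ φ)) z =
          c * (ball (0 : ℂ) 1).indicator (ψ * (⇑f ∘ φ)) z
        by_cases hz : z ∈ ball (0 : ℂ) 1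
        · simp only [indicator_of_mem hz, Pi.mul_apply, Function.comp_apply, Pi.smul_apply,
            smul_eq_mul, mul_left_comm]
        · simp only [indicator_of_notMem hz, mul_zero] }
  have hL : ∀ f, ‖L f‖ ≤ M * Real.sqrt ((1 + ‖φ 0‖) / (1 - ‖φ 0‖)) * ‖f‖ := fun f => by
    refine H2.norm_le (by positivity) fun r hr => ?_
    exact (hardyMean_congr (fun z hz => indicator_of_mem hz _) hr).trans_le (hmean f r hr)
  refine ⟨L.mkContinuous _ hL, fun f z hz => ?_, L.mkContinuous_norm_le (by positivity) hL⟩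
  exact indicator_of_mem hz _

/-! ### Automorphisms of the disc fixing the origin -/

/-- The inverse of an injective analytic function is analytic. It is continuous by the open mapping
theorem, hence differentiable away from the isolated critical values, and those are removable. -/
lemma differentiableOn_of_invOn {h k : ℂ → ℂ} {U V : Set ℂ} (hU : IsOpen U)
    (hd : DifferentiableOn ℂ h U) (hb : BijOn h U V) (hk : InvOn k h U V) :
    DifferentiableOn ℂ k V := by
  have han : AnalyticOnNhd ℂ h U := hd.analyticOnNhd hU
  have hnc : ∀ z ∈ U, ¬ ∀ᶠ y in 𝓝 z, h y = h z := by
    intro z hz H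
    have h1 : ∀ᶠ y in 𝓝 z, y = z := by
      filter_upwards [H, hU.mem_nhds hz] with y hy hyU using hb.injOn hyU hz hy
    obtain ⟨y, hy, hne⟩ := ((h1.filter_mono nhdsWithin_le_nhds).and
      (self_mem_nhdsWithin (a := z) (s := {z}ᶜ))).exists
    exact hne hy
  have hmap : ∀ z ∈ U, 𝓝 (h z) ≤ map h (𝓝 z) := fun z hz =>
    ((han z hz).eventually_constant_or_nhds_le_map_nhds_aux).resolve_left (hnc z hz)
  have hV : ∀ z ∈ U, V ∈ 𝓝 (h z) := fun z hz => by
    rw [← hb.image_eq]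
    exact hmap z hz (image_mem_map (hU.mem_nhds hz))
  have hcont : ∀ z ∈ U, ContinuousAt k (h z) := by
    intro z hz s hs
    rw [hk.1 hz] at hs
    have himg : h '' (s ∩ U) ∈ 𝓝 (h z) :=
      hmap z hz (image_mem_map (inter_mem hs (hU.mem_nhds hz)))
    refine mem_map.2 (mem_of_superset himg ?_)
    rintro _ ⟨y, ⟨hys, hyU⟩, rfl⟩
    rw [mem_preimage, hk.1 hyU]
    exact hys
  have hdiff : ∀ z ∈ U, deriv h z ≠ 0 → DifferentiableAt ℂ k (h z) := by
    intro z hz hne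
    have h1 : HasDerivAt h (deriv h z) (k (h z)) := by
      rw [hk.1 hz]
      exact (han z hz).differentiableAt.hasDerivAt
    refine (h1.of_local_left_inverse (hcont z hz) hne ?_).differentiableAt
    filter_upwards [hV z hz] with w hw using hk.2 hw
  intro w hw
  obtain ⟨z, hz, rfl⟩ := hb.surjOn hw
  refine DifferentiableAt.differentiableWithinAt (AnalyticAt.differentiableAt ?_)
  refine Complex.analyticAt_of_differentiable_on_punctured_nhds_of_continuousAt ?_ (hcont z hz)
  have hev : ∀ᶠ y in 𝓝[≠] z, deriv h y ≠ 0 := by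
    refine ((han z hz).deriv.eventually_eq_zero_or_eventually_ne_zero).resolve_left fun H => ?_
    obtain ⟨r, hr, hball⟩ := Metric.eventually_nhds_iff_ball.1 (H.and (hU.mem_nhds hz))
    refine hnc z hz (Metric.eventually_nhds_iff_ball.2 ⟨r, hr, fun y hy => ?_⟩)
    exact isOpen_ball.is_const_of_deriv_eq_zero (convex_ball z r).isPreconnected
      (hd.mono fun x hx => (hball x hx).2) (fun x hx => (hball x hx).1) hy (mem_ball_self hr)
  have htend : Tendsto k (𝓝[≠] (h z)) (𝓝[≠] z) := by
    refine tendsto_nhdsWithin_iff.2 ⟨?_, ?_⟩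
    · have := (hcont z hz).tendsto
      rw [hk.1 hz] at this
      exact this.mono_left nhdsWithin_le_nhds
    · filter_upwards [self_mem_nhdsWithin, mem_nhdsWithin_of_mem_nhds (hV z hz)] with v hv hvV hkv
      exact hv (by rw [mem_singleton_iff, ← hk.2 hvV, mem_singleton_iff.1 hkv])
  filter_upwards [htend.eventually hev, mem_nhdsWithin_of_mem_nhds (hV z hz)] with v hv hvV
  obtain ⟨y, hy, rfl⟩ := hb.surjOn hvV
  rw [hk.1 hy] at hv
  exact hdiff y hy hv

/-- An automorphism of the disc that fixes the origin is a rotation, by the Schwarz lemma applied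
to the map and to its inverse. -/
lemma IsDiscAut.exists_eq_mul {h : ℂ → ℂ} (hh : IsDiscAut h) (h0 : h 0 = 0) :
    ∃ u : ℂ, ∀ z ∈ ball (0 : ℂ) 1, h z = u * z := by
  obtain ⟨hd, hb⟩ := hh
  have hinv := hb.invOn_invFunOn
  set k := Function.invFunOn h (ball 0 1)
  have hkd := differentiableOn_of_invOn isOpen_ball hd hb hinv
  have hkm : MapsTo k (ball 0 1) (ball 0 1) := hb.surjOn.mapsTo_invFunOn
  have h0m : (0 : ℂ) ∈ ball (0 : ℂ) 1 := mem_ball_self one_pos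
  have hk0 : k 0 = 0 := by
    have := hinv.1 h0m
    rwa [h0] at this
  have hmc : MapsTo h (ball 0 1) (closedBall (h 0) 1) := by
    rw [h0]
    exact hb.mapsTo.mono_right ball_subset_closedBall
  have hz : (1 / 2 : ℂ) ∈ ball (0 : ℂ) 1 := by simp; norm_num
  have hle1 : ‖h (1 / 2)‖ ≤ ‖(1 / 2 : ℂ)‖ := Complex.norm_le_norm_of_mapsTo_ball hd
    (hb.mapsTo.mono_right ball_subset_closedBall) h0 (by simpa using hz)
  have hle2 : ‖(1 / 2 : ℂ)‖ ≤ ‖h (1 / 2)‖ := by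
    have := Complex.norm_le_norm_of_mapsTo_ball hkd (hkm.mono_right ball_subset_closedBall) hk0
      (z := h (1 / 2)) (by simpa using hb.mapsTo hz)
    rwa [hinv.1 hz] at this
  obtain ⟨u, -, hu⟩ := Complex.affine_of_mapsTo_ball_of_exists_norm_dslope_eq_div' hd hmc
    ⟨1 / 2, hz, by
      rw [dslope_of_ne _ (by norm_num), slope_def_field, h0, sub_zero, sub_zero, norm_div,
        le_antisymm hle1 hle2, div_one, div_self (by norm_num)]⟩
  exact ⟨u, fun z hz => by rw [hu hz, h0]; simp [mul_comm]⟩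

/-! ### The Cayley transform and affine maps of the half-plane -/

/-- The Cayley transform from the unit disc onto the right half-plane that sends the boundary point
`a` to infinity. -/
def cay (a z : ℂ) : ℂ := (a + z) / (a - z)

/-- The inverse of the Cayley transform `cay a`. -/
def icay (a w : ℂ) : ℂ := a * (w - 1) / (w + 1)

section Cayley

variable {a z w : ℂ}

lemma re_cay (ha : ‖a‖ = 1) (z : ℂ) : (cay a z).re = (1 - ‖z‖ ^ 2) / ‖a - z‖ ^ 2 := by
  have := congrFun (poissonKernel_eq_re_herglotzRieszKernel (c := 0) (w := z)) a
  simp only [poissonKernel_def, Function.comp_apply, herglotzRieszKernel_def, sub_zero, ha] at this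
  rw [cay, ← this, one_pow]

lemma ne_of_mem_disc (ha : ‖a‖ = 1) (hz : z ∈ ball (0 : ℂ) 1) : a - z ≠ 0 := by
  intro h
  rw [← sub_eq_zero.1 h] at hz
  simp [ha] at hz

lemma re_cay_pos (ha : ‖a‖ = 1) (hz : z ∈ ball (0 : ℂ) 1) : 0 < (cay a z).re := by
  rw [re_cay ha]
  have h1 : ‖z‖ < 1 := by simpa using hz
  have h2 := norm_pos_iff.2 (ne_of_mem_disc ha hz)
  have : 0 < 1 - ‖z‖ ^ 2 := by nlinarith [norm_nonneg z]
  positivity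

lemma add_one_ne_zero_of_re_nonneg (hw : 0 ≤ w.re) : w + 1 ≠ 0 := by
  intro h
  have := congrArg Complex.re h
  simp at this
  linarith

lemma one_le_norm_add_one (hw : 0 ≤ w.re) : 1 ≤ ‖w + 1‖ :=
  le_trans (by simpa using hw) ((Complex.re_le_norm (w + 1)))

lemma cay_add_one (hz : a - z ≠ 0) : cay a z + 1 = 2 * a / (a - z) := by
  rw [cay]
  field_simp
  ring

lemma icay_cay (ha : ‖a‖ = 1) (hz : a - z ≠ 0) : icay a (cay a z) = z := by
  have ha0 : a ≠ 0 := by rintro rfl; simp at ha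
  rw [icay, cay_add_one hz, cay]
  field_simp
  ring

lemma sub_icay (hw : w + 1 ≠ 0) : a - icay a w = 2 * a / (w + 1) := by
  rw [icay]
  field_simp
  ring

lemma cay_icay (ha : ‖a‖ = 1) (hw : w + 1 ≠ 0) : cay a (icay a w) = w := by
  have ha0 : a ≠ 0 := by rintro rfl; simp at ha
  rw [cay, sub_icay hw, icay]
  field_simp
  ring

lemma one_sub_norm_icay_sq (ha : ‖a‖ = 1) (hw : w + 1 ≠ 0) :
    1 - ‖icay a w‖ ^ 2 = 4 * w.re / ‖w + 1‖ ^ 2 := by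
  have h1 : ‖w + 1‖ ≠ 0 := norm_ne_zero_iff.2 hw
  have h2 : ‖w + 1‖ ^ 2 - ‖w - 1‖ ^ 2 = 4 * w.re := by
    rw [← Complex.normSq_eq_norm_sq, ← Complex.normSq_eq_norm_sq]
    simp [Complex.normSq_apply]
    ring
  rw [icay, norm_div, norm_mul, ha, one_mul, ← h2]
  field_simp

lemma one_sub_norm_sq_eq (ha : ‖a‖ = 1) (hz : z ∈ ball (0 : ℂ) 1) :
    1 - ‖z‖ ^ 2 = 4 * (cay a z).re / ‖cay a z + 1‖ ^ 2 := by
  have h := one_sub_norm_icay_sq ha (add_one_ne_zero_of_re_nonneg (re_cay_pos ha hz).le)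
  rwa [icay_cay ha (ne_of_mem_disc ha hz)] at h

lemma icay_mem (ha : ‖a‖ = 1) (hw : 0 < w.re) : icay a w ∈ ball (0 : ℂ) 1 := by
  have h0 := add_one_ne_zero_of_re_nonneg hw.le
  have h := one_sub_norm_icay_sq ha h0
  have h1 := norm_pos_iff.2 h0
  have : 0 < 4 * w.re / ‖w + 1‖ ^ 2 := by positivity
  rw [mem_ball_zero_iff]
  by_contra! hc
  nlinarith

lemma differentiableOn_cay (ha : ‖a‖ = 1) : DifferentiableOn ℂ (cay a) (ball 0 1) := by
  refine DifferentiableOn.div (by fun_prop) (by fun_prop) fun z hz => ne_of_mem_disc ha hz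

lemma differentiableAt_icay (hw : w + 1 ≠ 0) : DifferentiableAt ℂ (icay a) w := by
  unfold icay
  fun_prop (disch := assumption)

end Cayley

/-- The map of the unit disc that becomes `w ↦ A w + i B` on the half-plane. -/
def affDisc (a : ℂ) (A B : ℝ) (z : ℂ) : ℂ := icay a (A * cay a z + B * Complex.I)

section AffDisc

variable {a z : ℂ} {A B : ℝ}

lemma re_affine (A B : ℝ) (w : ℂ) : (A * w + B * Complex.I).re = A * w.re := by simp

lemma affDisc_mem (ha : ‖a‖ = 1) (hA : 0 < A) (hz : z ∈ ball (0 : ℂ) 1) :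
    affDisc a A B z ∈ ball (0 : ℂ) 1 :=
  icay_mem ha (by rw [re_affine]; exact mul_pos hA (re_cay_pos ha hz))

lemma cay_affDisc (ha : ‖a‖ = 1) (hA : 0 < A) (hz : z ∈ ball (0 : ℂ) 1) :
    cay a (affDisc a A B z) = A * cay a z + B * Complex.I :=
  cay_icay ha (add_one_ne_zero_of_re_nonneg
    (by rw [re_affine]; exact (mul_pos hA (re_cay_pos ha hz)).le))

lemma affDisc_affDisc {A' B' : ℝ} (ha : ‖a‖ = 1) (hA : 0 < A) (hz : z ∈ ball (0 : ℂ) 1) :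
    affDisc a A' B' (affDisc a A B z) = affDisc a (A' * A) (A' * B + B') z := by
  rw [affDisc, cay_affDisc ha hA hz, affDisc]
  congr 1
  push_cast
  ring

lemma affDisc_one_zero (ha : ‖a‖ = 1) (hz : z ∈ ball (0 : ℂ) 1) : affDisc a 1 0 z = z := by
  rw [affDisc]
  simp [icay_cay ha (ne_of_mem_disc ha hz)]

lemma differentiableOn_affDisc (ha : ‖a‖ = 1) (hA : 0 < A) :
    DifferentiableOn ℂ (affDisc a A B) (ball 0 1) := by
  intro z hz
  refine DifferentiableAt.comp_differentiableWithinAt z (differentiableAt_icay ?_)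
    (((differentiableOn_cay ha z hz).const_mul _).add_const _)
  exact add_one_ne_zero_of_re_nonneg
    (by rw [re_affine]; exact (mul_pos hA (re_cay_pos ha hz)).le)

lemma isDiscAut_affDisc (ha : ‖a‖ = 1) (hA : 0 < A) : IsDiscAut (affDisc a A B) := by
  refine ⟨differentiableOn_affDisc ha hA, ?_⟩
  refine BijOn.mk (fun z hz => affDisc_mem ha hA hz) ?_ ?_
  · refine LeftInvOn.injOn (f₁' := affDisc a A⁻¹ (-(A⁻¹ * B))) fun z hz => ?_
    rw [affDisc_affDisc ha hA hz, inv_mul_cancel₀ hA.ne', add_neg_cancel, affDisc_one_zero ha hz]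
  · intro z hz
    refine ⟨affDisc a A⁻¹ (-(A⁻¹ * B)) z, affDisc_mem ha (inv_pos.2 hA) hz, ?_⟩
    rw [affDisc_affDisc ha (inv_pos.2 hA) hz, mul_inv_cancel₀ hA.ne', mul_neg, ← mul_assoc,
      mul_inv_cancel₀ hA.ne', one_mul, neg_add_cancel, affDisc_one_zero ha hz]

/-- An affine map of the half-plane fixes the point at infinity. -/
lemma tendsto_affDisc (ha : ‖a‖ = 1) (hA : 0 < A) :
    Tendsto (affDisc a A B) (𝓝[ball 0 1] a) (𝓝 a) := by
  have ha0 : a ≠ 0 := by rintro rfl; simp at ha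
  have hA0 : (A : ℂ) ≠ 0 := by exact_mod_cast hA.ne'
  have hne : (A : ℂ) * (a + a) + (B * Complex.I + 1) * (a - a) ≠ 0 := by
    rw [sub_self, mul_zero, add_zero, ← two_mul]
    exact mul_ne_zero hA0 (mul_ne_zero two_ne_zero ha0)
  have hc : ContinuousAt (fun z => a * (A * (a + z) + (B * Complex.I - 1) * (a - z)) /
      (A * (a + z) + (B * Complex.I + 1) * (a - z))) a := by
    fun_prop (disch := assumption)
  have hval : a * (A * (a + a) + (B * Complex.I - 1) * (a - a)) /
      (A * (a + a) + (B * Complex.I + 1) * (a - a)) = a := by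
    simp only [sub_self, mul_zero, add_zero]
    field_simp
  have ht := hc.tendsto
  rw [hval] at ht
  refine (ht.mono_left nhdsWithin_le_nhds).congr' ?_
  filter_upwards [self_mem_nhdsWithin] with z hz
  have hz0 := ne_of_mem_disc ha hz
  have h1 : (A : ℂ) * cay a z + B * Complex.I - 1 =
      (A * (a + z) + (B * Complex.I - 1) * (a - z)) / (a - z) := by
    rw [cay]; field_simp; ring
  have h2 : (A : ℂ) * cay a z + B * Complex.I + 1 =
      (A * (a + z) + (B * Complex.I + 1) * (a - z)) / (a - z) := by
    rw [cay]; field_simp; ring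
  rw [affDisc, icay, h1, h2, mul_div_assoc', div_div_div_cancel_right₀ hz0]

/-- A finite boundary fixed point of an affine map of the half-plane. -/
lemma exists_isBoundaryFixedPoint_affDisc (ha : ‖a‖ = 1) {s : ℝ} (hs : A * s + B = s) :
    ∃ b, b ≠ a ∧ IsBoundaryFixedPoint (affDisc a A B) b := by
  have ha0 : a ≠ 0 := by rintro rfl; simp at ha
  have hw : (s * Complex.I : ℂ) + 1 ≠ 0 := add_one_ne_zero_of_re_nonneg (by simp)
  have hsub : a - icay a (s * Complex.I) ≠ 0 := by
    rw [sub_icay hw]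
    exact div_ne_zero (mul_ne_zero two_ne_zero ha0) hw
  refine ⟨icay a (s * Complex.I), fun h => hsub (by rw [h, sub_self]), ?_, ?_⟩
  · have h := one_sub_norm_icay_sq ha hw
    simp only [Complex.mul_re, Complex.ofReal_re, Complex.I_re, mul_zero, Complex.ofReal_im,
      zero_mul, sub_self, zero_div] at h
    rw [mem_sphere_zero_iff_norm]
    nlinarith [norm_nonneg (icay a (s * Complex.I))]
  · have hfix : (A : ℂ) * cay a (icay a (s * Complex.I)) + B * Complex.I = s * Complex.I := by
      have hs' : (A : ℂ) * s + B = s := by exact_mod_cast hs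
      rw [cay_icay ha hw]
      linear_combination Complex.I * hs'
    have hc1 : ContinuousAt (cay a) (icay a (s * Complex.I)) := by
      unfold cay
      fun_prop (disch := assumption)
    have hc2 : ContinuousAt (icay a) (A * cay a (icay a (s * Complex.I)) + B * Complex.I) := by
      rw [hfix]
      exact (differentiableAt_icay hw).continuousAt
    have hc : ContinuousAt (affDisc a A B) (icay a (s * Complex.I)) :=
      ContinuousAt.comp (f := fun z => (A : ℂ) * cay a z + B * Complex.I) hc2
        ((hc1.const_mul _).add continuousAt_const)
    have ht := hc.tendsto
    have hval : affDisc a A B (icay a (s * Complex.I)) = icay a (s * Complex.I) := by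
      rw [affDisc, hfix]
    rw [hval] at ht
    exact ht.mono_left nhdsWithin_le_nhds

end AffDisc

lemma IsBoundaryFixedPoint.congr {φ φ' : ℂ → ℂ} {b : ℂ} (h : EqOn φ φ' (ball 0 1))
    (hb : IsBoundaryFixedPoint φ' b) : IsBoundaryFixedPoint φ b := by
  refine ⟨hb.1, hb.2.congr' ?_⟩
  filter_upwards [self_mem_nhdsWithin] with z hz using (h hz).symm

lemma nhdsWithin_disc_neBot {a : ℂ} (ha : ‖a‖ = 1) : (𝓝[ball (0 : ℂ) 1] a).NeBot := by
  rw [← mem_closure_iff_nhdsWithin_neBot, closure_ball 0 one_ne_zero]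
  simp [ha]

/-- An automorphism of the disc with boundary fixed point `a` is an affine map of the half-plane.
Composed with the affine map that sends `φ 0` back to `0`, it is a rotation fixing `a`. -/
lemma IsDiscAut.exists_eqOn_affDisc {φ : ℂ → ℂ} {a : ℂ} (hφ : IsDiscAut φ)
    (ha : IsBoundaryFixedPoint φ a) :
    ∃ A B : ℝ, 0 < A ∧ EqOn φ (affDisc a A B) (ball 0 1) := by
  have ha1 : ‖a‖ = 1 := by simpa using ha.1
  have ha0 : a ≠ 0 := by rintro rfl; simp at ha1
  have h0 : φ 0 ∈ ball (0 : ℂ) 1 := hφ.2.mapsTo (mem_ball_self one_pos)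
  set x := (cay a (φ 0)).re with hx
  set y := (cay a (φ 0)).im with hy
  have hx0 : 0 < x := re_cay_pos ha1 h0
  have hτ : IsDiscAut (affDisc a x⁻¹ (-(x⁻¹ * y))) := isDiscAut_affDisc ha1 (inv_pos.2 hx0)
  have hcomp : IsDiscAut (affDisc a x⁻¹ (-(x⁻¹ * y)) ∘ φ) :=
    ⟨hτ.1.comp hφ.1 hφ.2.mapsTo, hτ.2.comp hφ.2⟩
  have hfix0 : (affDisc a x⁻¹ (-(x⁻¹ * y)) ∘ φ) 0 = 0 := by
    have hc : ((x⁻¹ : ℝ) : ℂ) * cay a (φ 0) + ((-(x⁻¹ * y) : ℝ) : ℂ) * Complex.I = 1 := by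
      rw [← Complex.re_add_im (cay a (φ 0)), ← hx, ← hy]
      have : (x : ℂ) ≠ 0 := by exact_mod_cast hx0.ne'
      push_cast
      field_simp
      ring
    rw [Function.comp_apply, affDisc, hc, icay]
    simp
  obtain ⟨u, hu⟩ := hcomp.exists_eq_mul hfix0
  have hmaps : ∀ᶠ z in 𝓝[ball 0 1] a, φ z ∈ ball (0 : ℂ) 1 := by
    filter_upwards [self_mem_nhdsWithin] with z hz using hφ.2.mapsTo hz
  have ht1 : Tendsto (affDisc a x⁻¹ (-(x⁻¹ * y)) ∘ φ) (𝓝[ball 0 1] a) (𝓝 a) :=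
    (tendsto_affDisc ha1 (inv_pos.2 hx0)).comp (tendsto_nhdsWithin_iff.2 ⟨ha.2, hmaps⟩)
  have ht2 : Tendsto (affDisc a x⁻¹ (-(x⁻¹ * y)) ∘ φ) (𝓝[ball 0 1] a) (𝓝 (u * a)) := by
    have : Tendsto (fun z => u * z) (𝓝[ball 0 1] a) (𝓝 (u * a)) :=
      ((continuous_const_mul u).tendsto a).mono_left nhdsWithin_le_nhds
    refine this.congr' ?_
    filter_upwards [self_mem_nhdsWithin] with z hz using (hu z hz).symm
  have := nhdsWithin_disc_neBot ha1
  have hu1 : u = 1 := by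
    have h := tendsto_nhds_unique ht2 ht1
    exact mul_right_cancel₀ ha0 (h.trans (one_mul a).symm)
  refine ⟨x, y, hx0, fun z hz => ?_⟩
  have h1 := hu z hz
  rw [hu1, one_mul, Function.comp_apply] at h1
  have h2 := affDisc_affDisc (A' := x) (B' := y) (B := -(x⁻¹ * y)) ha1 (inv_pos.2 hx0)
    (hφ.2.mapsTo hz)
  rw [h1, mul_inv_cancel₀ hx0.ne', mul_neg, ← mul_assoc, mul_inv_cancel₀ hx0.ne', one_mul,
    neg_add_cancel, affDisc_one_zero ha1 (hφ.2.mapsTo hz)] at h2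
  exact h2.symm

/-- A parabolic automorphism is a nontrivial vertical translation of the half-plane: otherwise the
affine map would have a second, finite, boundary fixed point. -/
lemma IsParabolicAut.exists_eqOn_affDisc {φ : ℂ → ℂ} {a : ℂ} (hφ : IsParabolicAut φ)
    (ha : IsBoundaryFixedPoint φ a) :
    ∃ t : ℝ, t ≠ 0 ∧ EqOn φ (affDisc a 1 t) (ball 0 1) := by
  have ha1 : ‖a‖ = 1 := by simpa using ha.1
  obtain ⟨A, B, hA, hAB⟩ := hφ.1.exists_eqOn_affDisc ha
  have hno : ∀ s : ℝ, A * s + B ≠ s := by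
    intro s hs
    obtain ⟨b, hba, hb⟩ := exists_isBoundaryFixedPoint_affDisc ha1 hs
    exact hba (hφ.2.unique (hb.congr hAB) ha)
  have hA1 : A = 1 := by
    by_contra hne
    have h1 : 1 - A ≠ 0 := sub_ne_zero.2 (Ne.symm hne)
    refine hno (B / (1 - A)) ?_
    field_simp
    ring
  subst hA1
  exact ⟨B, fun h => hno 0 (by simp [h]), hAB⟩

/-! ### Translations of the half-plane -/

/-- The parabolic automorphism of the disc that becomes `w ↦ w + i t` on the half-plane. -/
def shift (a : ℂ) (t : ℝ) : ℂ → ℂ := affDisc a 1 t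

section Shift

variable {a z : ℂ} {s t : ℝ}

lemma shift_mem (ha : ‖a‖ = 1) (hz : z ∈ ball (0 : ℂ) 1) : shift a t z ∈ ball (0 : ℂ) 1 :=
  affDisc_mem ha one_pos hz

lemma differentiableOn_shift (ha : ‖a‖ = 1) : DifferentiableOn ℂ (shift a t) (ball 0 1) :=
  differentiableOn_affDisc ha one_pos

lemma cay_shift (ha : ‖a‖ = 1) (hz : z ∈ ball (0 : ℂ) 1) :
    cay a (shift a t z) = cay a z + t * Complex.I := by
  rw [shift, cay_affDisc ha one_pos hz]
  simp

lemma shift_shift (ha : ‖a‖ = 1) (hz : z ∈ ball (0 : ℂ) 1) :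
    shift a s (shift a t z) = shift a (t + s) z := by
  rw [shift, shift, affDisc_affDisc ha one_pos hz, one_mul, one_mul, shift]

lemma shift_zero (ha : ‖a‖ = 1) (hz : z ∈ ball (0 : ℂ) 1) : shift a 0 z = z :=
  affDisc_one_zero ha hz

/-- The norm of the composition operator of a translation grows at most linearly. -/
lemma sqrt_shift_le (ha : ‖a‖ = 1) (t : ℝ) :
    Real.sqrt ((1 + ‖shift a t 0‖) / (1 - ‖shift a t 0‖)) ≤ 2 + |t| := by
  have h0 : (0 : ℂ) ∈ ball (0 : ℂ) 1 := mem_ball_self one_pos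
  have ha0 : a ≠ 0 := by rintro rfl; simp at ha
  have hm : ‖shift a t 0‖ < 1 := by simpa using shift_mem (t := t) ha h0
  have h := one_sub_norm_sq_eq ha (shift_mem (t := t) ha h0)
  have hc : cay a 0 = 1 := by simp [cay, ha0]
  rw [cay_shift ha h0, hc] at h
  simp only [Complex.add_re, Complex.one_re, Complex.re_ofReal_mul, Complex.I_re, mul_zero,
    add_zero, mul_one] at h
  set x := ‖shift a t 0‖
  have hx : 0 ≤ x := norm_nonneg _
  have hn : ‖(1 : ℂ) + t * Complex.I + 1‖ ≤ 2 + |t| := by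
    calc ‖(1 : ℂ) + t * Complex.I + 1‖ = ‖(2 : ℂ) + t * Complex.I‖ := by congr 1; ring
      _ ≤ ‖(2 : ℂ)‖ + ‖t * Complex.I‖ := norm_add_le _ _
      _ = 2 + |t| := by simp
  have hpos : 0 < 1 - x ^ 2 := by nlinarith
  have hN : 0 < ‖(1 : ℂ) + t * Complex.I + 1‖ := by
    refine lt_of_lt_of_le one_pos (one_le_norm_add_one ?_)
    simp
  have h4 : 4 / (1 - x ^ 2) = ‖(1 : ℂ) + t * Complex.I + 1‖ ^ 2 := by
    rw [h]
    field_simp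
  rw [Real.sqrt_le_left (by positivity)]
  calc (1 + x) / (1 - x) ≤ 4 / (1 - x ^ 2) := by
        rw [div_le_div_iff₀ (by linarith) hpos]
        nlinarith [mul_nonneg (sub_nonneg.2 hm.le) (sub_nonneg.2 hm.le), mul_nonneg hx hx]
    _ = ‖(1 : ℂ) + t * Complex.I + 1‖ ^ 2 := h4
    _ ≤ (2 + |t|) ^ 2 := by gcongr

lemma norm_cay_shift_ge (ha : ‖a‖ = 1) (hz : z ∈ ball (0 : ℂ) 1) :
    |t| - ‖cay a z‖ ≤ ‖cay a (shift a t z)‖ := by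
  rw [cay_shift ha hz, add_comm]
  have := norm_sub_le_norm_add (t * Complex.I : ℂ) (cay a z)
  simpa using this

end Shift

/-- Continuity at the boundary point `a`, read off at infinity in the half-plane. -/
lemma exists_forall_norm_sub_lt {ψ : ℂ → ℂ} {a : ℂ} (ha : ‖a‖ = 1)
    (hψ : ContinuousWithinAt ψ (ball 0 1) a) {ε : ℝ} (hε : 0 < ε) :
    ∃ R, 0 < R ∧ ∀ z ∈ ball (0 : ℂ) 1, R < ‖cay a z‖ → ‖ψ z - ψ a‖ < ε := by
  obtain ⟨δ, hδ, h⟩ := Metric.continuousWithinAt_iff.1 hψ ε hε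
  refine ⟨2 / δ + 1, by positivity, fun z hz hR => ?_⟩
  rw [← dist_eq_norm]
  refine h hz ?_
  have hz0 := norm_pos_iff.2 (ne_of_mem_disc ha hz)
  have h1 : ‖cay a z + 1‖ = 2 / ‖a - z‖ := by
    rw [cay_add_one (ne_of_mem_disc ha hz)]
    simp [ha]
  have h2 : ‖cay a z‖ ≤ ‖cay a z + 1‖ + 1 := by
    have := norm_sub_le (cay a z + 1) 1
    simpa using this
  have h3 : 2 / δ < 2 / ‖a - z‖ := by linarith
  rw [dist_eq_norm, norm_sub_rev]
  exact (div_lt_div_iff_of_pos_left two_pos hδ hz0).1 h3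

/-- Geometric growth is not bounded by linear growth. -/
lemma not_forall_pow_le_linear {q A B : ℝ} (hq : 1 < q) : ¬ ∀ n : ℕ, q ^ n ≤ A + B * n := by
  intro h
  have hq0 : 0 < q := one_pos.trans hq
  have h0 := tendsto_pow_const_div_const_pow_of_one_lt 0 hq
  have h1 := tendsto_pow_const_div_const_pow_of_one_lt 1 hq
  have hlim := (h0.const_mul A).add (h1.const_mul B)
  simp only [mul_zero, add_zero] at hlim
  have : (1 : ℝ) ≤ 0 := by
    refine ge_of_tendsto hlim (Eventually.of_forall fun n => ?_)
    have hp : 0 < q ^ n := pow_pos hq0 n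
    rw [mul_div_assoc', mul_div_assoc', ← add_div, le_div_iff₀ hp, one_mul, pow_zero, pow_one,
      mul_one]
    exact h n
  linarith

/-! ### The upper bound for the spectrum -/

lemma card_le_of_forall_sub_le {S : Finset ℕ} {L : ℝ}
    (h : ∀ j ∈ S, ∀ k ∈ S, (k : ℝ) - j ≤ L) : S.card ≤ ⌊L⌋₊ + 1 := by
  rcases S.eq_empty_or_nonempty with rfl | hS
  · simp
  have hsub : S ⊆ Finset.Icc (S.min' hS) (S.min' hS + ⌊L⌋₊) := by
    intro k hk
    rw [Finset.mem_Icc]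
    refine ⟨S.min'_le k hk, ?_⟩
    have h1 := h _ (S.min'_mem hS) k hk
    have h2 : k - S.min' hS ≤ ⌊L⌋₊ := by
      refine Nat.le_floor ?_
      rwa [Nat.cast_sub (S.min'_le k hk)]
    omega
  refine (Finset.card_le_card hsub).trans ?_
  rw [Nat.card_Icc]
  omega

/-- Along every orbit all but boundedly many factors are at most `m`, because the orbit moves with
constant speed in the half-plane. -/
lemma exists_prod_norm_le {ψ : ℂ → ℂ} {a : ℂ} {t m M : ℝ} (ha : ‖a‖ = 1) (ht : t ≠ 0)
    (hψ : ContinuousWithinAt ψ (ball 0 1) a) (hM : ∀ z ∈ ball (0 : ℂ) 1, ‖ψ z‖ ≤ M)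
    (hm : ‖ψ a‖ < m) :
    ∃ K, 0 ≤ K ∧ ∀ (n : ℕ), ∀ z ∈ ball (0 : ℂ) 1,
      ‖∏ k ∈ Finset.range n, ψ (shift a (k * t) z)‖ ≤ K * m ^ n := by
  classical
  obtain ⟨R, -, hR⟩ := exists_forall_norm_sub_lt ha hψ (sub_pos.2 hm)
  have hm0 : 0 < m := (norm_nonneg _).trans_lt hm
  -- the loss at each of the boundedly many orbit points of half-plane modulus at most `R`
  set Q := max 1 (M / m)
  have hQ1 : 1 ≤ Q := le_max_left _ _
  have hMQ : M ≤ m * Q := by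
    have : M / m ≤ Q := le_max_right _ _
    rwa [div_le_iff₀' hm0] at this
  refine ⟨Q ^ (⌊2 * R / |t|⌋₊ + 1), by positivity, fun n z hz => ?_⟩
  set S := (Finset.range n).filter fun k : ℕ => ‖cay a (shift a (k * t) z)‖ ≤ R
  have hcard : S.card ≤ ⌊2 * R / |t|⌋₊ + 1 := by
    refine card_le_of_forall_sub_le fun j hj k hk => ?_
    have hj' := (Finset.mem_filter.1 hj).2
    have hk' := (Finset.mem_filter.1 hk).2
    rw [cay_shift ha hz] at hj' hk'
    rw [le_div_iff₀ (abs_pos.2 ht)]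
    have h1 : ((k : ℝ) - j) * |t| ≤ |((k : ℝ) - j) * t| := by
      rw [abs_mul]
      exact mul_le_mul_of_nonneg_right (le_abs_self _) (abs_nonneg _)
    have h2 : |((k : ℝ) - j) * t| = ‖(cay a z + (k * t : ℝ) * Complex.I) -
        (cay a z + (j * t : ℝ) * Complex.I)‖ := by
      have : (cay a z + (k * t : ℝ) * Complex.I) - (cay a z + (j * t : ℝ) * Complex.I) =
          ((((k : ℝ) - j) * t : ℝ) : ℂ) * Complex.I := by
        push_cast
        ring
      rw [this, norm_mul, Complex.norm_I, mul_one, Complex.norm_real, Real.norm_eq_abs]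
    have h3 := norm_sub_le (cay a z + (k * t : ℝ) * Complex.I) (cay a z + (j * t : ℝ) * Complex.I)
    linarith
  have hfac : ∀ k ∈ Finset.range n, ‖ψ (shift a (k * t) z)‖ ≤ m * if k ∈ S then Q else 1 := by
    intro k hk
    have hkz := shift_mem (t := k * t) ha hz
    split_ifs with hkS
    · exact (hM _ hkz).trans hMQ
    · rw [mul_one]
      have hlt : R < ‖cay a (shift a (k * t) z)‖ := by
        by_contra! hle
        exact hkS (Finset.mem_filter.2 ⟨hk, hle⟩)
      have h1 := hR _ hkz hlt
      have h2 := norm_sub_norm_le (ψ (shift a (k * t) z)) (ψ a)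
      linarith
  calc ‖∏ k ∈ Finset.range n, ψ (shift a (k * t) z)‖
      = ∏ k ∈ Finset.range n, ‖ψ (shift a (k * t) z)‖ := norm_prod _ _
    _ ≤ ∏ k ∈ Finset.range n, (m * if k ∈ S then Q else 1) :=
        Finset.prod_le_prod (fun _ _ => norm_nonneg _) hfac
    _ = m ^ n * Q ^ S.card := by
        rw [Finset.prod_mul_distrib, Finset.prod_const, Finset.card_range, Finset.prod_ite_mem,
          Finset.inter_eq_right.2 (Finset.filter_subset _ _), Finset.prod_const]
    _ ≤ m ^ n * Q ^ (⌊2 * R / |t|⌋₊ + 1) := by gcongr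
    _ = _ := mul_comm _ _

lemma differentiableOn_prod_shift {ψ : ℂ → ℂ} {a : ℂ} (ha : ‖a‖ = 1) (t : ℝ)
    (hψ : DifferentiableOn ℂ ψ (ball 0 1)) (n : ℕ) :
    DifferentiableOn ℂ (fun z => ∏ k ∈ Finset.range n, ψ (shift a (k * t) z)) (ball 0 1) := by
  refine DifferentiableOn.fun_finsetProd fun k _ => ?_
  exact hψ.comp (differentiableOn_shift ha) fun z hz => shift_mem ha hz

lemma IsWeightedComposition.pow {ψ : ℂ → ℂ} {a : ℂ} {t : ℝ} (ha : ‖a‖ = 1)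
    {C : H2 →L[ℂ] H2} (hC : IsWeightedComposition ψ (shift a t) C) (n : ℕ) :
    IsWeightedComposition (fun z => ∏ k ∈ Finset.range n, ψ (shift a (k * t) z))
      (shift a (n * t)) (C ^ n) := by
  induction n with
  | zero =>
    intro f z hz
    simp [shift_zero ha hz]
  | succ n ih =>
    intro f z hz
    have hz' := shift_mem (t := t) ha hz
    rw [pow_succ', mul_apply_eq_comp, hC _ z hz, ih f _ hz', shift_shift ha hz]
    simp only [Finset.prod_range_succ', shift_shift ha hz, Nat.cast_add, Nat.cast_one,
      Nat.cast_zero, zero_mul, shift_zero ha hz]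
    have : ∀ k : ℝ, t + k * t = (k + 1) * t := fun k => by ring
    simp only [this]
    ring

lemma norm_le_of_mem_spectrum {ψ : ℂ → ℂ} {a : ℂ} {t : ℝ} (ha : ‖a‖ = 1) (ht : t ≠ 0)
    (hψ : MemHInfty ψ) (hψa : ContinuousWithinAt ψ (ball 0 1) a) {C : H2 →L[ℂ] H2}
    (hC : IsWeightedComposition ψ (shift a t) C) {l : ℂ} (hl : l ∈ spectrum ℂ C) :
    ‖l‖ ≤ ‖ψ a‖ := by
  refine le_of_forall_gt_imp_ge_of_dense fun m hm => ?_
  by_contra! hlm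
  have hm0 : 0 < m := (norm_nonneg _).trans_lt hm
  obtain ⟨hd, M, hM⟩ := hψ
  obtain ⟨K, hK0, hK⟩ := exists_prod_norm_le ha ht hψa hM hm
  refine not_forall_pow_le_linear (q := ‖l‖ / m) (A := K * 2) (B := K * |t|)
    ((one_lt_div hm0).2 hlm) fun n => ?_
  obtain ⟨D, hD, hDn⟩ := exists_isWeightedComposition (differentiableOn_prod_shift ha t hd n)
    (hK n) (differentiableOn_shift (t := n * t) ha) fun z hz => shift_mem ha hz
  have hpow : C ^ n = D := (hC.pow ha n).unique hD
  have h1 := spectrum.norm_le_norm_mul_of_mem (spectrum.pow_mem_pow C n hl)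
  have h2 : ‖(1 : H2 →L[ℂ] H2)‖ ≤ 1 := ContinuousLinearMap.norm_id_le
  rw [hpow, norm_pow] at h1
  have h3 := sqrt_shift_le ha (n * t)
  rw [abs_mul, Nat.abs_cast] at h3
  have h4 : ‖D‖ ≤ K * m ^ n * (2 + n * |t|) :=
    hDn.trans (mul_le_mul_of_nonneg_left h3 (by positivity))
  have h5 : ‖l‖ ^ n ≤ K * m ^ n * (2 + n * |t|) :=
    h1.trans ((mul_le_of_le_one_right (norm_nonneg D) h2).trans h4)
  rw [div_pow, div_le_iff₀ (by positivity)]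
  linarith

/-! ### Invertibility -/

lemma H2.ext_disc {f g : H2} (h : ∀ z ∈ ball (0 : ℂ) 1, f z = g z) : f = g := by
  refine Subtype.ext (funext fun z => ?_)
  by_cases hz : z ∈ ball (0 : ℂ) 1
  · exact h z hz
  · exact (f.mem.eq_zero_off z hz).trans (g.mem.eq_zero_off z hz).symm

/-- If `ψ` is bounded below, the inverse is again a weighted composition operator. -/
lemma IsWeightedComposition.isUnit {ψ : ℂ → ℂ} {a : ℂ} {t ε : ℝ} (ha : ‖a‖ = 1)
    (hψ : DifferentiableOn ℂ ψ (ball 0 1)) (hε : 0 < ε) (hb : ∀ z ∈ ball (0 : ℂ) 1, ε ≤ ‖ψ z‖)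
    {C : H2 →L[ℂ] H2} (hC : IsWeightedComposition ψ (shift a t) C) : IsUnit C := by
  have hne : ∀ z ∈ ball (0 : ℂ) 1, ψ z ≠ 0 := fun z hz =>
    norm_pos_iff.1 (hε.trans_le (hb z hz))
  have hmaps : MapsTo (shift a (-t)) (ball 0 1) (ball 0 1) := fun z hz => shift_mem ha hz
  obtain ⟨D, hD, -⟩ := exists_isWeightedComposition (ψ := fun z => (ψ (shift a (-t) z))⁻¹)
    (φ := shift a (-t)) (M := ε⁻¹)
    ((hψ.comp (differentiableOn_shift ha) hmaps).inv fun z hz => hne _ (hmaps hz))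
    (fun z hz => by
      rw [norm_inv]
      exact inv_anti₀ hε (hb _ (hmaps hz)))
    (differentiableOn_shift ha) hmaps
  refine isUnit_iff_exists.2 ⟨D, ?_, ?_⟩ <;> refine ContinuousLinearMap.ext fun f => ?_ <;>
    refine H2.ext_disc fun z hz => ?_
  · rw [mul_apply_eq_comp, hC _ z hz, hD f _ (shift_mem ha hz)]
    simp only [shift_shift ha hz, add_neg_cancel, shift_zero ha hz]
    rw [mul_inv_cancel_left₀ (hne z hz)]
    rfl
  · rw [mul_apply_eq_comp, hD _ z hz, hC f _ (shift_mem ha hz), shift_shift ha hz,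
      neg_add_cancel, shift_zero ha hz, inv_mul_cancel_left₀ (hne _ (hmaps hz))]
    rfl

/-! ### Functions vanishing on a backward orbit -/

/-- The point evaluation bound in terms of the half-plane coordinate. -/
lemma H2.norm_apply_le (f : H2) {a z : ℂ} (ha : ‖a‖ = 1) (hz : z ∈ ball (0 : ℂ) 1) :
    ‖f z‖ ≤ ‖cay a z + 1‖ / Real.sqrt (cay a z).re * ‖f‖ := by
  have hx := re_cay_pos ha hz
  have hN := norm_pos_iff.2 (add_one_ne_zero_of_re_nonneg hx.le)
  refine abs_le_of_sq_le_sq' ?_ (by positivity) |>.2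
  refine (f.norm_sq_apply_le hz).trans_eq ?_
  rw [one_sub_norm_sq_eq ha hz, mul_pow, div_pow, Real.sq_sqrt hx.le]
  field_simp

/-- Along the backward orbit of `z₀` a solution of the eigenvalue recursion with `|l| < |ψ(a)|`
would grow geometrically, whereas members of `H²` grow at most linearly there. -/
lemma H2.apply_eq_zero_of_recursion {ψ : ℂ → ℂ} {a l z₀ : ℂ} {t : ℝ} (ha : ‖a‖ = 1) (ht : t ≠ 0)
    (hψa : ContinuousWithinAt ψ (ball 0 1) a) (hz₀ : z₀ ∈ ball (0 : ℂ) 1) (hl0 : l ≠ 0)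
    (hl : ‖l‖ < ‖ψ a‖) (hne : ∀ k : ℕ, ψ (shift a (-((k + 1 : ℕ) * t)) z₀) ≠ 0) (f : H2)
    (hrec : ∀ k : ℕ, l * f (shift a (-((k + 1 : ℕ) * t)) z₀) =
      ψ (shift a (-((k + 1 : ℕ) * t)) z₀) * f (shift a (-(k * t)) z₀)) : f z₀ = 0 := by
  have hl0' : 0 < ‖l‖ := norm_pos_iff.2 hl0
  set ζ : ℕ → ℂ := fun k => shift a (-(k * t)) z₀ with hζ
  have hζm : ∀ k, ζ k ∈ ball (0 : ℂ) 1 := fun k => shift_mem ha hz₀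
  by_contra hf0
  have hfne : ∀ k, f (ζ k) ≠ 0 := by
    intro k
    induction k with
    | zero => simpa [hζ, shift_zero ha hz₀] using hf0
    | succ k ih =>
      intro h
      have h1 := hrec k
      change l * f (ζ (k + 1)) = ψ (ζ (k + 1)) * f (ζ k) at h1
      rw [h, mul_zero] at h1
      exact mul_ne_zero (hne k) ih h1.symm
  obtain ⟨m', hlm, hmψ⟩ := exists_between hl
  obtain ⟨R, -, hR⟩ := exists_forall_norm_sub_lt ha hψa (sub_pos.2 hmψ)
  obtain ⟨N, hN⟩ := exists_nat_gt ((R + ‖cay a z₀‖) / |t|)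
  rw [div_lt_iff₀ (abs_pos.2 ht)] at hN
  have hlarge : ∀ k ≥ N, m' ≤ ‖ψ (ζ k)‖ := by
    intro k hk
    have h1 := norm_cay_shift_ge (t := -(k * t)) ha hz₀
    rw [abs_neg, abs_mul, Nat.abs_cast] at h1
    have h2 : (N : ℝ) * |t| ≤ k * |t| := by gcongr
    have h3 := hR _ (hζm k) (by simp only [hζ]; linarith)
    have h4 := norm_sub_norm_le (ψ a) (ψ (ζ k))
    rw [norm_sub_rev] at h4
    linarith
  have hgrow : ∀ j : ℕ, (m' / ‖l‖) ^ j * ‖f (ζ N)‖ ≤ ‖f (ζ (N + j))‖ := by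
    intro j
    induction j with
    | zero => simp
    | succ j ih =>
      have h1 := congrArg norm (hrec (N + j))
      change ‖l * f (ζ (N + j + 1))‖ = ‖ψ (ζ (N + j + 1)) * f (ζ (N + j))‖ at h1
      rw [norm_mul, norm_mul] at h1
      have h2 : ‖f (ζ (N + (j + 1)))‖ = ‖ψ (ζ (N + j + 1))‖ * ‖f (ζ (N + j))‖ / ‖l‖ := by
        rw [eq_div_iff hl0'.ne', mul_comm, ← h1]
        rfl
      have h3 := hlarge (N + j + 1) (by omega)
      rw [h2, pow_succ]
      have hm0 : 0 ≤ m' := hl0'.le.trans hlm.le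
      calc (m' / ‖l‖) ^ j * (m' / ‖l‖) * ‖f (ζ N)‖
          = m' * ((m' / ‖l‖) ^ j * ‖f (ζ N)‖) / ‖l‖ := by ring
        _ ≤ ‖ψ (ζ (N + j + 1))‖ * ‖f (ζ (N + j))‖ / ‖l‖ := by gcongr
  have hx := re_cay_pos ha hz₀
  set S := Real.sqrt (cay a z₀).re
  have hS : 0 < S := Real.sqrt_pos.2 hx
  have hup : ∀ k : ℕ, ‖f (ζ k)‖ ≤ (‖cay a z₀ + 1‖ + k * |t|) / S * ‖f‖ := by
    intro k
    have h1 := f.norm_apply_le ha (hζm k)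
    have h2 : cay a (ζ k) = cay a z₀ + ((-(k * t) : ℝ) : ℂ) * Complex.I := cay_shift ha hz₀
    have h3 : (cay a (ζ k)).re = (cay a z₀).re := by
      rw [h2, Complex.add_re, Complex.re_ofReal_mul, Complex.I_re, mul_zero, add_zero]
    have h4 : ‖cay a (ζ k) + 1‖ ≤ ‖cay a z₀ + 1‖ + k * |t| := by
      rw [h2, add_right_comm]
      refine (norm_add_le _ _).trans_eq ?_
      rw [norm_mul, Complex.norm_I, mul_one, Complex.norm_real, Real.norm_eq_abs, abs_neg, abs_mul,
        Nat.abs_cast]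
    rw [h3] at h1
    exact h1.trans (by gcongr)
  have hfN : 0 < ‖f (ζ N)‖ := norm_pos_iff.2 (hfne N)
  refine not_forall_pow_le_linear (q := m' / ‖l‖)
    (A := (‖cay a z₀ + 1‖ + N * |t|) / S * ‖f‖ / ‖f (ζ N)‖) (B := |t| / S * ‖f‖ / ‖f (ζ N)‖)
    ((one_lt_div hl0').2 hlm) fun j => ?_
  have h1 := (hgrow j).trans (hup (N + j))
  rw [← le_div_iff₀ hfN] at h1
  refine h1.trans_eq ?_
  push_cast
  field_simp
  ring

lemma norm_sub_le_norm_one_sub {u v : ℂ} (hu : ‖u‖ < 1) (hv : ‖v‖ < 1) :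
    ‖u - v‖ ≤ ‖1 - (starRingEnd ℂ) v * u‖ := by
  refine abs_le_of_sq_le_sq' ?_ (norm_nonneg _) |>.2
  have key : ‖1 - (starRingEnd ℂ) v * u‖ ^ 2 - ‖u - v‖ ^ 2 = (1 - ‖u‖ ^ 2) * (1 - ‖v‖ ^ 2) := by
    simp only [← Complex.normSq_eq_norm_sq, Complex.normSq_apply, Complex.sub_re, Complex.sub_im,
      Complex.mul_re, Complex.mul_im, Complex.conj_re, Complex.conj_im, Complex.one_re,
      Complex.one_im]
    ring
  have h1 : 0 ≤ 1 - ‖u‖ ^ 2 := by nlinarith [norm_nonneg u]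
  have h2 : 0 ≤ 1 - ‖v‖ ^ 2 := by nlinarith [norm_nonneg v]
  nlinarith [mul_nonneg h1 h2]

lemma one_sub_conj_mul_ne_zero {u v : ℂ} (hu : ‖u‖ < 1) (hv : ‖v‖ < 1) :
    1 - (starRingEnd ℂ) v * u ≠ 0 := by
  intro h
  have h1 : ‖(starRingEnd ℂ) v * u‖ = 1 := by rw [← sub_eq_zero.1 h, norm_one]
  rw [norm_mul, RCLike.norm_conj] at h1
  nlinarith [norm_nonneg u, norm_nonneg v]

/-- Dividing out a zero of a function bounded by `1` gives a function whose norm is at most that of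
the Cauchy kernel `1 / (1 - conj z₀ * z)`. -/
lemma hardyMean_dslope_le {q : ℂ → ℂ} {z₀ : ℂ} (hz₀ : z₀ ∈ ball (0 : ℂ) 1)
    (hq : DifferentiableOn ℂ q (ball 0 1)) (hq1 : ∀ z ∈ ball (0 : ℂ) 1, ‖q z‖ ≤ 1)
    (hq0 : q z₀ = 0) {r : ℝ} (hr : r ∈ Ioo (0 : ℝ) 1) :
    hardyMean (dslope q z₀) r ≤ 1 / (1 - ‖z₀‖ ^ 2) := by
  have hz1 : ‖z₀‖ < 1 := by simpa using hz₀
  have hd : DifferentiableOn ℂ (dslope q z₀) (ball 0 1) :=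
    (Complex.differentiableOn_dslope (isOpen_ball.mem_nhds hz₀)).2 hq
  have hcirc : ∀ ρ ∈ Ioo (0 : ℝ) 1, ‖z₀‖ < ρ →
      hardyMean (dslope q z₀) ρ ≤ 1 / (ρ ^ 2 - ‖z₀‖ ^ 2) := by
    intro ρ hρ hzρ
    have hpos : 0 < ρ ^ 2 - ‖z₀‖ ^ 2 := by nlinarith [norm_nonneg z₀]
    have hne : ∀ z ∈ sphere (0 : ℂ) ρ, z - z₀ ≠ 0 := by
      intro z hz h
      rw [sub_eq_zero.1 h] at hz
      rw [mem_sphere_zero_iff_norm] at hz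
      exact hzρ.ne hz
    have hP : Real.circleAverage (fun z => (1 / ‖z - z₀‖ ^ 2 : ℝ)) 0 ρ =
        1 / (ρ ^ 2 - ‖z₀‖ ^ 2) := by
      have h1 : Real.circleAverage (poissonKernel 0 z₀ • fun _ => (1 : ℂ)) 0 ρ = 1 :=
        DiffContOnCl.circleAverage_poissonKernel_smul (f := fun _ => (1 : ℂ)) diffContOnCl_const
          (by simpa using hzρ)
      have h2 : Real.circleAverage (poissonKernel 0 z₀ • fun _ => (1 : ℂ)) 0 ρ =
          Real.circleAverage (Complex.ofRealCLM ∘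
            fun z => (ρ ^ 2 - ‖z₀‖ ^ 2) • (1 / ‖z - z₀‖ ^ 2 : ℝ)) 0 ρ := by
        refine Real.circleAverage_congr_sphere fun z hz => ?_
        rw [abs_of_pos hρ.1, mem_sphere_zero_iff_norm] at hz
        simp only [Pi.smul_apply', poissonKernel_def, sub_zero, hz, Function.comp_apply,
          Complex.ofRealCLM_apply, smul_eq_mul, Complex.real_smul, mul_one]
        congr 1
        ring
      have hint : CircleIntegrable (fun z => (ρ ^ 2 - ‖z₀‖ ^ 2) • (1 / ‖z - z₀‖ ^ 2 : ℝ)) 0 ρ := by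
        refine ContinuousOn.circleIntegrable hρ.1.le ?_
        refine continuousOn_const.mul (continuousOn_const.div (by fun_prop) fun z hz => ?_)
        exact pow_ne_zero 2 (norm_ne_zero_iff.2 (hne z hz))
      rw [h2, Complex.ofRealCLM.circleAverage_comp_comm hint, Complex.ofRealCLM_apply,
        Real.circleAverage_fun_smul, smul_eq_mul] at h1
      rw [eq_div_iff hpos.ne', mul_comm]
      exact_mod_cast h1
    rw [← hP]
    refine Real.circleAverage_mono (circleIntegrable_norm_sq hd hρ)
      (ContinuousOn.circleIntegrable hρ.1.le
        (continuousOn_const.div (by fun_prop) fun z hz =>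
          pow_ne_zero 2 (norm_ne_zero_iff.2 (hne z hz)))) fun z hz => ?_
    rw [abs_of_pos hρ.1] at hz
    have hzne : z ≠ z₀ := sub_ne_zero.1 (hne z hz)
    rw [dslope_of_ne _ hzne, slope_def_field, hq0, sub_zero, norm_div, div_pow]
    have := hq1 z (sphere_subset_ball hρ.2 hz)
    gcongr
    exact pow_le_one₀ (norm_nonneg _) this
  have hlim : Tendsto (fun ρ : ℝ => 1 / (ρ ^ 2 - ‖z₀‖ ^ 2)) (𝓝[<] 1)
      (𝓝 (1 / (1 - ‖z₀‖ ^ 2))) := by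
    have hc : ContinuousAt (fun ρ : ℝ => 1 / (ρ ^ 2 - ‖z₀‖ ^ 2)) 1 := by
      have h1 : (1 : ℝ) ^ 2 - ‖z₀‖ ^ 2 ≠ 0 := by nlinarith [norm_nonneg z₀]
      fun_prop (disch := assumption)
    have := hc.tendsto.mono_left (nhdsWithin_le_nhds (s := Iio 1))
    rwa [one_pow] at this
  refine ge_of_tendsto hlim ?_
  filter_upwards [Ioo_mem_nhdsLT hr.2, Ioo_mem_nhdsLT hz1] with ρ h1 h2
  exact (hardyMean_mono hd hr.1 h1.1 h1.2).trans (hcirc ρ ⟨hr.1.trans h1.1, h1.2⟩ h2.1)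

/-- A function of `H²` that vanishes at the backward orbit of `z₀`, but at `z₀` is comparable to
the reproducing kernel, uniformly for `z₀` away from `a`. It comes from the Blaschke product of the
full orbit, which is a Möbius transform of `exp (-2π w / |t|)` on the half-plane. -/
lemma H2.exists_vanishing_on_orbit {a z₀ : ℂ} {t : ℝ} (ha : ‖a‖ = 1) (ht : t ≠ 0)
    (hz₀ : z₀ ∈ ball (0 : ℂ) 1) :
    ∃ g : H2, ‖g‖ ^ 2 ≤ 1 / (1 - ‖z₀‖ ^ 2) ∧
      (∀ k : ℕ, g (shift a (-((k + 1 : ℕ) * t)) z₀) = 0) ∧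
      Real.exp (-(2 * Real.pi * (cay a z₀).re / |t|)) ≤ ‖g z₀‖ * (1 - ‖z₀‖ ^ 2) := by
  have ht' : 0 < |t| := abs_pos.2 ht
  have hx := re_cay_pos ha hz₀
  have hz1 : 0 < 1 - ‖z₀‖ ^ 2 := by
    have : ‖z₀‖ < 1 := by simpa using hz₀
    nlinarith [norm_nonneg z₀]
  set γ : ℝ := -(2 * Real.pi / |t|) with hγ
  have hγ0 : γ < 0 := neg_lt_zero.2 (by positivity)
  set e : ℂ → ℂ := fun z => Complex.exp (γ * cay a z) with he
  have hnorm : ∀ z, ‖e z‖ = Real.exp (γ * (cay a z).re) := fun z => by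
    rw [he, Complex.norm_exp, Complex.re_ofReal_mul]
  have he1 : ∀ z ∈ ball (0 : ℂ) 1, ‖e z‖ < 1 := fun z hz => by
    rw [hnorm, Real.exp_lt_one_iff]
    exact mul_neg_of_neg_of_pos hγ0 (re_cay_pos ha hz)
  have hed : DifferentiableOn ℂ e (ball 0 1) := ((differentiableOn_cay ha).const_mul _).cexp
  set q : ℂ → ℂ := fun z => (e z - e z₀) / (1 - (starRingEnd ℂ) (e z₀) * e z) with hq
  have hden : ∀ z ∈ ball (0 : ℂ) 1, 1 - (starRingEnd ℂ) (e z₀) * e z ≠ 0 := fun z hz =>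
    one_sub_conj_mul_ne_zero (he1 z hz) (he1 z₀ hz₀)
  have hqd : DifferentiableOn ℂ q (ball 0 1) :=
    (hed.sub_const _).div ((hed.const_mul _).const_sub _) hden
  have hq1 : ∀ z ∈ ball (0 : ℂ) 1, ‖q z‖ ≤ 1 := fun z hz => by
    rw [hq, norm_div]
    exact div_le_one_of_le₀ (norm_sub_le_norm_one_sub (he1 z hz) (he1 z₀ hz₀)) (norm_nonneg _)
  have hq0 : q z₀ = 0 := by simp [hq]
  have hmean := fun r hr => hardyMean_dslope_le hz₀ hqd hq1 hq0 (r := r) hr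
  have hgd : DifferentiableOn ℂ (dslope q z₀) (ball 0 1) :=
    (Complex.differentiableOn_dslope (isOpen_ball.mem_nhds hz₀)).2 hqd
  have hgval : ∀ z ∈ ball (0 : ℂ) 1,
      (H2.ofMemHardy (memHardy_indicator hgd hmean)) z = dslope q z₀ z := fun z hz => by
    rw [H2.coe_ofMemHardy, indicator_of_mem hz]
  refine ⟨H2.ofMemHardy (memHardy_indicator hgd hmean), ?_, fun k => ?_, ?_⟩
  · have hle : ‖H2.ofMemHardy (memHardy_indicator hgd hmean)‖ ≤
        Real.sqrt (1 / (1 - ‖z₀‖ ^ 2)) := by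
      refine H2.norm_le (Real.sqrt_nonneg _) fun r hr => ?_
      rw [Real.sq_sqrt (by positivity), H2.coe_ofMemHardy,
        hardyMean_congr (fun z hz => indicator_of_mem hz _) hr]
      exact hmean r hr
    calc _ ≤ Real.sqrt (1 / (1 - ‖z₀‖ ^ 2)) ^ 2 := by
          exact pow_le_pow_left₀ (H2.norm_nonneg' _) hle 2
      _ = _ := Real.sq_sqrt (by positivity)
  · rw [hgval _ (shift_mem ha hz₀)]
    have hc := cay_shift (t := -((k + 1 : ℕ) * t)) ha hz₀
    have hne : shift a (-((k + 1 : ℕ) * t)) z₀ ≠ z₀ := by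
      intro h
      rw [h] at hc
      have h2 := add_eq_left.1 hc.symm
      simp only [mul_eq_zero, Complex.I_ne_zero, or_false, Complex.ofReal_eq_zero, neg_eq_zero,
        ht, Nat.cast_eq_zero, Nat.succ_ne_zero] at h2
    have hee : e (shift a (-((k + 1 : ℕ) * t)) z₀) = e z₀ := by
      simp only [he]
      rw [Complex.exp_eq_exp_iff_exists_int, hc]
      have hπ : (γ : ℂ) * (((-((k + 1 : ℕ) * t) : ℝ) : ℂ) * Complex.I) =
          ((t / |t| : ℝ) : ℂ) * ((k + 1 : ℕ) : ℂ) * (2 * Real.pi * Complex.I) := by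
        rw [hγ]
        push_cast
        ring
      -- translation by `i t` changes the exponent by `± 2π i`, according to the sign of `t`
      rw [mul_add, hπ]
      rcases lt_or_gt_of_ne ht with h | h
      · refine ⟨-((k + 1 : ℕ) : ℤ), ?_⟩
        rw [abs_of_neg h, div_neg, div_self ht]
        push_cast
        ring
      · refine ⟨((k + 1 : ℕ) : ℤ), ?_⟩
        rw [abs_of_pos h, div_self ht]
        push_cast
        ring
    rw [dslope_of_ne _ hne, slope_def_field, hq0, hq]
    simp only [hee, sub_self, zero_div]
  · rw [hgval _ hz₀, dslope_same]
    have hzne := ne_of_mem_disc ha hz₀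
    have hzn : ‖a - z₀‖ ≠ 0 := norm_ne_zero_iff.2 hzne
    have hcd : HasDerivAt (cay a) (2 * a / (a - z₀) ^ 2) z₀ := by
      have h := ((hasDerivAt_id z₀).const_add a).div ((hasDerivAt_id z₀).const_sub a) hzne
      refine h.congr_deriv ?_
      simp only [id]
      congr 1
      ring
    have hed' : HasDerivAt e (e z₀ * (γ * (2 * a / (a - z₀) ^ 2))) z₀ :=
      (hcd.const_mul (γ : ℂ)).cexp
    have hqd' : HasDerivAt q (e z₀ * (γ * (2 * a / (a - z₀) ^ 2)) /
        (1 - (starRingEnd ℂ) (e z₀) * e z₀)) z₀ := by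
      have h := (hed'.sub_const (e z₀)).div ((hed'.const_mul ((starRingEnd ℂ) (e z₀))).const_sub 1)
        (hden z₀ hz₀)
      refine h.congr_deriv ?_
      rw [sub_self, zero_mul, sub_zero, sq (1 - _), mul_div_mul_right _ _ (hden z₀ hz₀)]
    set x := (cay a z₀).re with hxdef
    set τ := 2 * Real.pi * x / |t| with hτ
    have hτ0 : 0 < τ := by positivity
    have hγx : γ * x = -τ := by rw [hγ, hτ]; ring
    have hnd : ‖1 - (starRingEnd ℂ) (e z₀) * e z₀‖ = 1 - Real.exp (-(2 * τ)) := by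
      have h1 : (starRingEnd ℂ) (e z₀) * e z₀ = ((Real.exp (-(2 * τ)) : ℝ) : ℂ) := by
        rw [← Complex.normSq_eq_conj_mul_self, Complex.normSq_eq_norm_sq, hnorm, hγx,
          ← Real.exp_nat_mul]
        congr 2
        push_cast
        ring
      rw [h1, ← Complex.ofReal_one, ← Complex.ofReal_sub, Complex.norm_real, Real.norm_of_nonneg]
      rw [sub_nonneg, Real.exp_le_one_iff]
      linarith
    have hexp : 1 - Real.exp (-(2 * τ)) ≤ 2 * τ := by
      linarith [Real.add_one_le_exp (-(2 * τ))]
    have hexp0 : 0 < 1 - Real.exp (-(2 * τ)) := by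
      rw [sub_pos, Real.exp_lt_one_iff]
      linarith
    have h1x : 1 - ‖z₀‖ ^ 2 = x * ‖a - z₀‖ ^ 2 := by
      rw [hxdef, re_cay ha]
      field_simp
    rw [hqd'.deriv, norm_div, hnd, norm_mul, hnorm, hγx, norm_mul, norm_div, norm_mul, norm_pow, ha,
      Complex.norm_real, Real.norm_of_nonpos hγ0.le, Complex.norm_ofNat, h1x]
    have hval : Real.exp (-τ) * (-γ * (2 * 1 / ‖a - z₀‖ ^ 2)) / (1 - Real.exp (-(2 * τ))) *
        (x * ‖a - z₀‖ ^ 2) = Real.exp (-τ) * (2 * τ / (1 - Real.exp (-(2 * τ)))) := by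
      have : -γ * x = τ := by linarith
      rw [← this]
      field_simp
    rw [hval]
    exact le_mul_of_one_le_right (Real.exp_pos _).le ((one_le_div hexp0).2 hexp)

/-! ### The lower bound for the spectrum -/

/-- If `l - C` has the right inverse `D`, then `|ψ z₀|` is bounded below for every `z₀` whose
backward orbit avoids the zeros of `ψ`. -/
lemma IsWeightedComposition.exp_le_of_mul_eq_one {ψ : ℂ → ℂ} {a l z₀ : ℂ} {t : ℝ} (ha : ‖a‖ = 1)
    (ht : t ≠ 0) (hψa : ContinuousWithinAt ψ (ball 0 1) a) {C D : H2 →L[ℂ] H2}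
    (hC : IsWeightedComposition ψ (shift a t) C) (hl0 : l ≠ 0) (hl : ‖l‖ < ‖ψ a‖)
    (hD : (algebraMap ℂ (H2 →L[ℂ] H2) l - C) * D = 1) (hz₀ : z₀ ∈ ball (0 : ℂ) 1)
    (hne : ∀ k : ℕ, ψ (shift a (-((k + 1 : ℕ) * t)) z₀) ≠ 0) :
    Real.exp (-(2 * Real.pi * (cay a z₀).re / |t|)) ≤ 2 * (1 + |t|) * ‖D‖ * ‖ψ z₀‖ := by
  obtain ⟨g, hgn, hgz, hg0⟩ := H2.exists_vanishing_on_orbit ha ht hz₀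
  refine hg0.trans ?_
  have hx := re_cay_pos ha hz₀
  set f := D g with hf
  have heq : ∀ z ∈ ball (0 : ℂ) 1, g z = l * f z - ψ z * f (shift a t z) := by
    intro z hz
    have h1 : l • f - C f = g := by
      have := congrArg (fun T : H2 →L[ℂ] H2 => T g) hD
      simpa [Algebra.algebraMap_eq_smul_one] using this
    rw [← hC f z hz, ← h1, H2.coe_sub, Pi.sub_apply, H2.coe_smul, Pi.smul_apply, smul_eq_mul]
  have hf0 : f z₀ = 0 := by
    refine H2.apply_eq_zero_of_recursion ha ht hψa hz₀ hl0 hl hne f fun k => ?_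
    have h1 := heq _ (shift_mem (t := -((k + 1 : ℕ) * t)) ha hz₀)
    have h2 : -(((k + 1 : ℕ) : ℝ) * t) + t = -(k * t) := by
      push_cast
      ring
    rw [hgz k, shift_shift ha hz₀, h2] at h1
    exact sub_eq_zero.1 h1.symm
  have hgf : ‖g z₀‖ = ‖ψ z₀‖ * ‖f (shift a t z₀)‖ := by
    rw [heq z₀ hz₀, hf0, mul_zero, zero_sub, norm_neg, norm_mul]
  have hc := cay_shift (t := t) ha hz₀
  set S := Real.sqrt (cay a z₀).re with hS
  have hS0 : 0 < S := Real.sqrt_pos.2 hx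
  have hSx : S ^ 2 = (cay a z₀).re := Real.sq_sqrt hx.le
  set n := ‖cay a z₀ + 1‖ with hn
  have hn1 : 1 ≤ n := one_le_norm_add_one hx.le
  have h1z : 1 - ‖z₀‖ ^ 2 = (2 * S / n) ^ 2 := by
    rw [one_sub_norm_sq_eq ha hz₀, ← hSx]
    ring
  have hgn' : ‖g‖ ≤ n / (2 * S) := by
    refine abs_le_of_sq_le_sq' ?_ (by positivity) |>.2
    rw [h1z] at hgn
    refine hgn.trans_eq ?_
    field_simp
  have hfn : ‖f (shift a t z₀)‖ ≤ n * (1 + |t|) / S * (‖D‖ * (n / (2 * S))) := by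
    have h2 := f.norm_apply_le ha (shift_mem (t := t) ha hz₀)
    have h3 : (cay a (shift a t z₀)).re = (cay a z₀).re := by
      rw [hc, Complex.add_re, Complex.re_ofReal_mul, Complex.I_re, mul_zero, add_zero]
    have h4 : ‖cay a (shift a t z₀) + 1‖ ≤ n * (1 + |t|) := by
      have h5 : ‖cay a (shift a t z₀) + 1‖ ≤ n + |t| := by
        rw [hc, add_right_comm]
        refine (norm_add_le _ _).trans_eq ?_
        rw [norm_mul, Complex.norm_I, mul_one, Complex.norm_real, Real.norm_eq_abs]
      nlinarith [abs_nonneg t]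
    have h5 : ‖f‖ ≤ ‖D‖ * (n / (2 * S)) :=
      (D.le_opNorm g).trans (mul_le_mul_of_nonneg_left hgn' (norm_nonneg D))
    rw [h3] at h2
    exact h2.trans (by gcongr)
  rw [hgf, h1z]
  calc ‖ψ z₀‖ * ‖f (shift a t z₀)‖ * (2 * S / n) ^ 2
      ≤ ‖ψ z₀‖ * (n * (1 + |t|) / S * (‖D‖ * (n / (2 * S)))) * (2 * S / n) ^ 2 := by gcongr
    _ = 2 * (1 + |t|) * ‖D‖ * ‖ψ z₀‖ := by
      field_simp

/-- If `ψ` has a zero, the backward orbit of that zero contains a last one, since backward orbits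
converge to `a` too and `ψ` does not vanish near `a`. -/
lemma exists_zero_forall_ne_zero {ψ : ℂ → ℂ} {a z : ℂ} {t : ℝ} (ha : ‖a‖ = 1) (ht : t ≠ 0)
    (hψa : ContinuousWithinAt ψ (ball 0 1) a) (h0 : ψ a ≠ 0) (hz : z ∈ ball (0 : ℂ) 1)
    (hψz : ψ z = 0) :
    ∃ z₀ ∈ ball (0 : ℂ) 1, ψ z₀ = 0 ∧ ∀ k : ℕ, ψ (shift a (-((k + 1 : ℕ) * t)) z₀) ≠ 0 := by
  obtain ⟨R, -, hR⟩ := exists_forall_norm_sub_lt ha hψa (norm_pos_iff.2 h0)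
  obtain ⟨N, hN⟩ := exists_nat_gt ((R + ‖cay a z‖) / |t|)
  rw [div_lt_iff₀ (abs_pos.2 ht)] at hN
  set Z : Set ℕ := {k | ψ (shift a (-(k * t)) z) = 0}
  have hbdd : BddAbove Z := by
    refine ⟨N, fun k hk => ?_⟩
    by_contra! hlt
    have h1 := norm_cay_shift_ge (t := -(k * t)) ha hz
    rw [abs_neg, abs_mul, Nat.abs_cast] at h1
    have h2 : (N : ℝ) * |t| ≤ k * |t| := by gcongr
    have h3 := hR _ (shift_mem ha hz) (by linarith : R < ‖cay a (shift a (-(k * t)) z)‖)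
    rw [show ψ (shift a (-(k * t)) z) = 0 from hk, zero_sub, norm_neg] at h3
    exact lt_irrefl _ h3
  have hnonempty : Z.Nonempty := ⟨0, by
    change ψ (shift a (-((0 : ℕ) * t)) z) = 0
    rw [Nat.cast_zero, zero_mul, neg_zero, shift_zero ha hz, hψz]⟩
  have hmem : sSup Z ∈ Z := Nat.sSup_mem hnonempty hbdd
  refine ⟨shift a (-(sSup Z * t)) z, shift_mem ha hz, hmem, fun k hk => ?_⟩
  have hmem' : sSup Z + (k + 1) ∈ Z := by
    change ψ (shift a (-((sSup Z + (k + 1) : ℕ) * t)) z) = 0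
    rw [shift_shift ha hz] at hk
    rw [← hk]
    congr 2
    push_cast
    ring
  have := le_csSup hbdd hmem'
  omega

lemma mem_spectrum_of_norm_lt {ψ : ℂ → ℂ} {a l : ℂ} {t : ℝ} (ha : ‖a‖ = 1) (ht : t ≠ 0)
    (hψ : DifferentiableOn ℂ ψ (ball 0 1)) (hψa : ContinuousWithinAt ψ (ball 0 1) a)
    {C : H2 →L[ℂ] H2} (hC : IsWeightedComposition ψ (shift a t) C) (hCu : ¬ IsUnit C)
    (hl : ‖l‖ < ‖ψ a‖) : l ∈ spectrum ℂ C := by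
  rcases eq_or_ne l 0 with rfl | hl0
  · exact (spectrum.zero_mem_iff ℂ).2 hCu
  rw [spectrum.mem_iff]
  intro hu
  obtain ⟨D, hD, -⟩ := isUnit_iff_exists.1 hu
  have hbound := fun z₀ hz₀ hne =>
    hC.exp_le_of_mul_eq_one (z₀ := z₀) ha ht hψa hl0 hl hD hz₀ hne
  have hψa0 : 0 < ‖ψ a‖ := (norm_nonneg _).trans_lt hl
  by_cases hzero : ∃ z ∈ ball (0 : ℂ) 1, ψ z = 0
  · obtain ⟨z, hz, hψz⟩ := hzero
    obtain ⟨z₀, hz₀, hψz₀, hne⟩ :=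
      exists_zero_forall_ne_zero ha ht hψa (norm_pos_iff.1 hψa0) hz hψz
    have h := hbound z₀ hz₀ hne
    rw [hψz₀, norm_zero, mul_zero] at h
    exact absurd h (not_le.2 (Real.exp_pos _))
  · push Not at hzero
    -- small values of `ψ` are taken only at points of half-plane modulus at most `R`
    obtain ⟨R, hR0, hR⟩ := exists_forall_norm_sub_lt ha hψa (half_pos hψa0)
    set δ := Real.exp (-(2 * Real.pi * R / |t|))
    have hδ : 0 < δ := Real.exp_pos _
    set Q := 2 * (1 + |t|) * ‖D‖ with hQ
    have hQ0 : 0 ≤ Q := by positivity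
    have hex : ∃ z ∈ ball (0 : ℂ) 1, ‖ψ z‖ < min (‖ψ a‖ / 2) (δ / (Q + 1)) := by
      by_contra! hall
      exact hCu (hC.isUnit ha hψ (lt_min (half_pos hψa0) (by positivity)) hall)
    obtain ⟨z, hz, hzlt⟩ := hex
    have hx : (cay a z).re ≤ R := by
      refine (Complex.re_le_norm _).trans ?_
      by_contra! hlt
      have h1 := hR z hz hlt
      have h2 := norm_sub_norm_le (ψ a) (ψ z)
      rw [norm_sub_rev] at h2
      have h3 := hzlt.trans_le (min_le_left _ _)
      linarith
    have h1 := hbound z hz fun k => hzero _ (shift_mem ha hz)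
    have h2 : δ ≤ Real.exp (-(2 * Real.pi * (cay a z).re / |t|)) := by
      refine Real.exp_le_exp.2 (neg_le_neg ?_)
      gcongr
    have h3 : ‖ψ z‖ < δ / (Q + 1) := hzlt.trans_le (min_le_right _ _)
    rw [lt_div_iff₀ (by positivity)] at h3
    have h4 := h2.trans h1
    nlinarith [norm_nonneg (ψ z), norm_pos_iff.2 (hzero z hz)]

end WCO

end

theorem theorem3p8 (φ ψ : ℂ → ℂ) (a : ℂ)
    (hφ : WCO.IsParabolicAut φ) (ha : WCO.IsDenjoyWolffPoint φ a)
    (hψ : WCO.MemHInfty ψ) (hψa : ContinuousWithinAt ψ (Metric.ball 0 1) a) :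
    ∃ C : WCO.H2 →L[ℂ] WCO.H2, WCO.IsWeightedComposition ψ φ C ∧
      (¬ IsUnit C → spectrum ℂ C = {z : ℂ | ‖z‖ ≤ ‖ψ a‖}) := by
  have ha1 : ‖a‖ = 1 := by simpa using ha.1.1
  obtain ⟨t, ht, hφt⟩ := hφ.exists_eqOn_affDisc ha.1
  obtain ⟨hd, M, hM⟩ := id hψ
  obtain ⟨C, hC, -⟩ := WCO.exists_isWeightedComposition hd hM hφ.1.1 hφ.1.2.mapsTo
  have hC' : WCO.IsWeightedComposition ψ (WCO.shift a t) C := fun f z hz => by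
    rw [hC f z hz, hφt hz]
    rfl
  refine ⟨C, hC, fun hCu => Subset.antisymm
    (fun l hl => WCO.norm_le_of_mem_spectrum ha1 ht hψ hψa hC' hl) ?_⟩
  rcases eq_or_ne (ψ a) 0 with h0 | h0
  · intro l hl
    have : l = 0 := by simpa [h0] using hl
    rw [this]
    exact (spectrum.zero_mem_iff ℂ).2 hCu
  · have hsub : ball (0 : ℂ) ‖ψ a‖ ⊆ spectrum ℂ C := fun l hl =>
      WCO.mem_spectrum_of_norm_lt ha1 ht hd hψa hC' hCu (by simpa using hl)
    have hcl := closure_minimal hsub (spectrum.isClosed C)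
    rw [closure_ball 0 (norm_ne_zero_iff.2 h0)] at hcl
    exact fun l hl => hcl (by simpa using hl)
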